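/- Let $q$ be a power of $2$, let $V$ be a $6$-dimensional vector space over $\mathbb F_q$, and let $\mathcal W(5,q)$ be the symplectic polar space of ${\rm PG}(5,q)={\rm PG}(V)$ defined by a non-degenerate alternating form $B$; its lines are the lines of ${\rm PG}(5,q)$ that are totally isotropic for $B$. Let $Q$ be a quadratic form on $V$ with polar form $B$, let $N\in V$ with $Q(N)\neq 0$, and let $N^\perp=\{x\in V: B(N,x)=0\}$. Consider the pencil of quadrics consisting of the quadrics $Q(x)+c\,B(N,x)^2=0$ ($c\in\mathbb F_q$) and of the quadric $B(N,x)^2=0$. Its base locus is the parabolic quadric $\mathcal Q(4,q)=\{Q=0\}\cap N^\perp$, which has nucleus $N$; the quadric $B(N,x)^2=0$ is the cone with vertex $N$ over $\mathcal Q(4,q)$, and of the other $q$ quadrics $q/2$ are elliptic and $q/2$ are hyperbolic. Let $\mathcal E_j\ne\mathcal E_k$ be two elliptic quadrics of this pencil. (1) A relative hemisystem of an elliptic quadric $\mathcal E$ of the pencil is a set of $q^2(q^2-1)/2$ points of $\mathcal E\setminus\mathcal Q(4,q)$ that has exactly $q/2$ points in common with each line contained in $\mathcal E$ that meets $\mathcal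 Q(4,q)$ in exactly one point. Let $\mathcal R_j$, $\mathcal R_k$ be relative hemisystems of $\mathcal E_j$, $\mathcal E_k$, and let $\mathcal O_1=\mathcal R_j\cup\mathcal R_k\cup\mathcal Q(4,q)$. Then every line $\ell$ of $\mathcal W(5,q)$ satisfies $$|\ell\cap\mathcal O_1|\in\left\{0,\,1,\,2,\,\tfrac q2+1,\,q+1\right\},$$ and exactly $(q+1)(q^2+1)$ lines of $\mathcal W(5,q)$ are contained in $\mathcal O_1$. (2) Let $q=2^{2h+1}$ with $h>0$, let $\mathcal T$ be a Suzuki–Tits ovoid of $\mathcal Q(4,q)$, and let $Sz(q)$ be the Suzuki group fixing $\mathcal T$, acting on ${\rm PG}(5,q)$ as the derived subgroup of the group of all linear isometries of $Q$ that fix $N$ and stabilise $\mathcal T$. Here a Suzuki–Tits ovoid of $\mathcal Q(4,q)$ is a set which, in suitable coordinates of $N^\perp$ for which $Q|_{N^\perp}=X_0X_3+X_1X_2+X_4^2$, consists of the point $(0,0,0,1,0)$ and of the points $(1,x,y,\,xy+x^{\sigma+2}+y^{\sigma},\,x^{2^h+1}+y^{2^h})$, $x,y\in\mathbb F_q$,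 where $\sigma=2^{h+1}$. Let $A_j$ be an $Sz(q)$-orbit on $\mathcal E_j\setminus\mathcal Q(4,q)$ of size $(q^3-q^2)(q-\sqrt{2q}+1)/2$, let $B_k$ be an $Sz(q)$-orbit on $\mathcal E_k\setminus\mathcal Q(4,q)$ of size $(q^3-q^2)(q+\sqrt{2q}+1)/2$, and let $\mathcal O_2=A_j\cup B_k\cup\mathcal Q(4,q)$. Then every line $\ell$ of $\mathcal W(5,q)$ satisfies $$|\ell\cap\mathcal O_2|\in\left\{0,\,1,\,2,\,\tfrac{q-\sqrt{2q}}2+1,\,\tfrac q2+1,\,\tfrac{q+\sqrt{2q}}2+1,\,q+1\right\},$$ where $|\ell\cap\mathcal O_2|=\frac q2+1$ if and only if $\ell$ is contained in $\mathcal E_j$ or in $\mathcal E_k$ and meets $\mathcal Q(4,q)$ in exactly one point, that point belonging to $\mathcal T$. Exactly $(q+1)(q^2+1)$ lines of $\mathcal W(5,q)$ are contained in $\mathcal O_2$. -/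

import Mathlib

open Module
open scoped LinearAlgebra.Projectivization Pointwise

/-- The points of the projective space `ℙ F V` that lie on the subspace `U`. -/
def pointsOf {F V : Type*} [Field F] [AddCommGroup V] [Module F V]
    (U : Submodule F V) : Set (ℙ F V) :=
  {p | p.submodule ≤ U}

/-- The projective lines of the symplectic polar space of the alternating form `B`: the totally
isotropic subspaces of vector dimension `2`. -/
def IsPolarLine {F V : Type*} [Field F] [AddCommGroup V] [Module F V]
    (B : LinearMap.BilinForm F V) (l : Submodule F V) : Prop :=
  finrank F l = 2 ∧ ∀ x ∈ l, ∀ y ∈ l, B x y = 0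

/-- The set of singular points of a quadratic form. -/
def quadric {F V : Type*} [Field F] [AddCommGroup V] [Module F V]
    (Q : QuadraticForm F V) : Set (ℙ F V) :=
  {p | ∀ x ∈ p.submodule, Q x = 0}

/-- For `V` of dimension `6` over a finite field: `Q` defines an elliptic quadric of `PG(5, q)`,
i.e. `Q` is non-degenerate and its quadric contains no plane of `PG(5, q)` (in characteristic `2`
and even dimension, non-degeneracy of `Q` is non-degeneracy of its polar form). -/
def IsElliptic {F V : Type*} [Field F] [AddCommGroup V] [Module F V]
    (Q : QuadraticForm F V) : Prop :=
  LinearMap.BilinForm.Nondegenerate Q.polarBilin ∧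
    ¬ ∃ U : Submodule F V, finrank F U = 3 ∧ ∀ x ∈ U, Q x = 0

/-- The member `Q + c B(N, ·)²` of the pencil spanned by `Q` and by the double hyperplane
`B(N, ·)² = 0`, where `B` is the polar form of `Q`. If `Q N ≠ 0`, then `Q` restricts to a parabolic
quadric with nucleus `N` on the hyperplane `N^⊥ : B(N, ·) = 0`, and each point of `N^⊥` is on
a line joining `N` to that parabolic quadric; so the quadric `B(N, ·)² = 0` is the cone with vertex
`N` over it. In characteristic `2` all the forms `Q + c B(N, ·)²` have the polar form `B`. -/
noncomputable def pencilForm {F V : Type*} [Field F] [AddCommGroup V] [Module F V]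
    (Q : QuadraticForm F V) (N : V) (c : F) : QuadraticForm F V :=
  Q + c • QuadraticMap.linMulLin (Q.polarBilin N) (Q.polarBilin N)

/-- The base locus of the pencil: the parabolic quadric `Q(4, q)` cut out by `Q` on `N^⊥`. -/
def baseLocus {F V : Type*} [Field F] [AddCommGroup V] [Module F V]
    (Q : QuadraticForm F V) (N : V) : Set (ℙ F V) :=
  quadric Q ∩ pointsOf (LinearMap.ker (Q.polarBilin N))

/-- `R` is a relative hemisystem of the quadric `E` with respect to the subset `P` of `E` (used for
an elliptic quadric `E` of the pencil and for `P = Q(4, q)`), where `q = |F|`. -/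
def IsRelativeHemisystem {F V : Type*} [Field F] [AddCommGroup V] [Module F V]
    (E P R : Set (ℙ F V)) : Prop :=
  R ⊆ E \ P ∧ 2 * R.ncard = Nat.card F ^ 2 * (Nat.card F ^ 2 - 1) ∧
    ∀ l : Submodule F V, finrank F l = 2 → pointsOf l ⊆ E → (pointsOf l ∩ P).ncard = 1 →
      2 * (pointsOf l ∩ R).ncard = Nat.card F

/-- Coordinates of the Suzuki-Tits ovoid of the parabolic quadric `X₀X₃ + X₁X₂ + X₄² = 0` of
`PG(4, q)`, `q = 2 ^ (2 h + 1)`. With `σ : x ↦ x ^ 2 ^ (h + 1)`, so that `σ² : x ↦ x ^ 2`, its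
projection from the nucleus `(0, 0, 0, 0, 1)` is the Tits ovoid of `PG(3, q)` with the points
`(0, 0, 0, 1)` and `(1, x, y, xy + x ^ (σ + 2) + y ^ σ)`; the last coordinate below is the square
root of `x ^ (σ + 2) + y ^ σ`. -/
def titsCoords (F : Type*) [Field F] (h : ℕ) : Set (Fin 5 → F) :=
  {![0, 0, 0, 1, 0]} ∪
    {v | ∃ x y : F, v = ![1, x, y, x * y + x ^ (2 ^ (h + 1) + 2) + y ^ 2 ^ (h + 1),
      x ^ (2 ^ h + 1) + y ^ 2 ^ h]}

/-- `T` is a Suzuki-Tits ovoid of the parabolic quadric cut out by `Q` on the hyperplane `N^⊥`: in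
suitable coordinates of `N^⊥` the quadric is `X₀X₃ + X₁X₂ + X₄² = 0` and `T` is as above. -/
def IsSuzukiTitsOvoid {F V : Type*} [Field F] [AddCommGroup V] [Module F V]
    (h : ℕ) (Q : QuadraticForm F V) (N : V) (T : Set (ℙ F V)) : Prop :=
  ∃ e : Fin 5 → V, (∀ i, Q.polarBilin N (e i) = 0) ∧
    (∀ x : Fin 5 → F, Q (∑ i, x i • e i) = x 0 * x 3 + x 1 * x 2 + x 4 ^ 2) ∧
    T = {p | ∃ x ∈ titsCoords F h, p.submodule = Submodule.span F {∑ i, x i • e i}}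

/-- The group of linear isometries of `Q`. -/
def isometryGroup {F V : Type*} [Field F] [AddCommGroup V] [Module F V]
    (Q : QuadraticForm F V) : Subgroup (V ≃ₗ[F] V) where
  carrier := {g | ∀ x, Q (g x) = Q x}
  mul_mem' := by
    intro a b ha hb x
    exact (ha (b x)).trans (hb x)
  one_mem' := fun _ => rfl
  inv_mem' := by
    intro a ha x
    have h1 := ha (a⁻¹ x)
    have h2 : a (a⁻¹ x) = x := a.apply_symm_apply x
    rw [h2] at h1
    exact h1.symm

/-- The isometries of `Q` that fix the vector `N` and stabilise the point set `T`. They stabilise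
every quadric of the pencil. -/
def ovoidStabilizer {F V : Type*} [Field F] [AddCommGroup V] [Module F V]
    (Q : QuadraticForm F V) (N : V) (T : Set (ℙ F V)) : Subgroup (V ≃ₗ[F] V) :=
  isometryGroup Q ⊓ MulAction.stabilizer (V ≃ₗ[F] V) N ⊓ MulAction.stabilizer (V ≃ₗ[F] V) T

/-- The Suzuki group `Sz(q)` of the Suzuki-Tits ovoid `T`, acting on the whole of `V`. The group
induced by `ovoidStabilizer Q N T` on `N^⊥` is the full group `Sz(q)` of projectivities of `Q(4, q)`
stabilising `T`, and the kernel of this restriction is the group of order `2` generated by the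
transvection with centre `N`; hence `ovoidStabilizer Q N T = Sz(q) × 2`, and `Sz(q)`, which
is perfect for `q > 2`, is its derived subgroup. -/
def suzukiGroup {F V : Type*} [Field F] [AddCommGroup V] [Module F V]
    (Q : QuadraticForm F V) (N : V) (T : Set (ℙ F V)) : Subgroup (V ≃ₗ[F] V) :=
  ⁅ovoidStabilizer Q N T, ovoidStabilizer Q N T⁆

/-- `A` is an orbit of the group `G` on the point set `X`. -/
def IsOrbitOn {F V : Type*} [Field F] [AddCommGroup V] [Module F V]
    (G : Subgroup (V ≃ₗ[F] V)) (X A : Set (ℙ F V)) : Prop :=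
  ∃ p ∈ X, A = MulAction.orbit G p

/-!
Two members of the pencil meet exactly in the base locus `Q(4, q)`. A totally isotropic line lies on
a given member or meets it in exactly one point, because the square root of a quadratic form is
additive on a totally isotropic subspace in characteristic `2`. Hence a line of the polar space
either lies on `Q(4, q)`, or lies on one of the two elliptic quadrics, `E` say, and meets `Q(4, q)`
in a single point, or has at most two points in common with the union. In the second case its
intersection number is one more than its number of points in the chosen subset of `E`. This number
is less than `q`, so the lines contained in the union are the `(q + 1)(q² + 1)` lines of `Q(4, q)`.

For an orbit `A` of the Suzuki group, call the degree of a point of `E \ Q(4, q)` the number of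
points of the ovoid that are orthogonal to it. The Suzuki group is transitive on the ovoid, so the
degree is constant on `A` and all hyperplanes `P^⊥` with `P` in the ovoid meet `A` in equally many
points. Write `|A| = q²(q - 1)(q + 1 - s)/2` with `s = ±√(2q)`. As `q + 1 + s` divides `q² + 1` and
is coprime to `(q - 1)q²`, counting the incident pairs forces degree `q + 1 + s` on `A`, and the
variance of the degree then forces degree `q + 1 - s` off `A`. The degrees of the points other than
`P` of a line on `E` that meets `Q(4, q)` only in `P` sum to `q² + q` if `P` is in the ovoid and to
`q² - q` if it is not. So `A` has `q/2`, respectively `(q - s)/2`, points on that line.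
-/

section QuadraticForms

variable {F V : Type*} [Field F] [AddCommGroup V] [Module F V] {Q : QuadraticForm F V} {N : V}

theorem polarBilin_comm (Q : QuadraticForm F V) (x y : V) :
    Q.polarBilin x y = Q.polarBilin y x :=
  QuadraticMap.polar_comm _ _ _

theorem map_add_polarBilin (Q : QuadraticForm F V) (x y : V) :
    Q (x + y) = Q x + Q y + Q.polarBilin x y :=
  QuadraticMap.map_add _ _ _

theorem map_smul_sq (Q : QuadraticForm F V) (a : F) (x : V) : Q (a • x) = a ^ 2 * Q x := by
  rw [QuadraticMap.map_smul, sq, smul_eq_mul]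

theorem ne_zero_of_map_ne_zero {x : V} (hx : Q x ≠ 0) : x ≠ 0 := by
  rintro rfl
  exact hx Q.map_zero

theorem polarBilin_self [CharP F 2] (Q : QuadraticForm F V) (x : V) : Q.polarBilin x x = 0 := by
  rw [QuadraticMap.polarBilin_apply_apply, QuadraticMap.polar_self, two_smul,
    CharTwo.add_self_eq_zero]

theorem polarBilin_eq_zero_of_mem_span {s : Set V} {x y : V}
    (hs : ∀ z ∈ s, Q.polarBilin z y = 0) (hx : x ∈ Submodule.span F s) :
    Q.polarBilin x y = 0 :=
  Submodule.span_le (p := LinearMap.ker (Q.polarBilin.flip y)).2 hs hx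

theorem map_eq_zero_of_mem_span {s : Set V} {x : V} (hs : ∀ z ∈ s, Q z = 0)
    (hss : ∀ z ∈ s, ∀ w ∈ s, Q.polarBilin z w = 0) (hx : x ∈ Submodule.span F s) : Q x = 0 := by
  induction hx using Submodule.span_induction with
  | mem z hz => exact hs z hz
  | zero => exact Q.map_zero
  | add y z hy hz hQy hQz =>
    have hyz : Q.polarBilin y z = 0 := polarBilin_eq_zero_of_mem_span (fun w hw => by
      rw [polarBilin_comm]
      exact polarBilin_eq_zero_of_mem_span (fun u hu => hss u hu w hw) hz) hy
    rw [map_add_polarBilin, hQy, hQz, hyz, add_zero, add_zero]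
  | smul a y _ hQy => rw [map_smul_sq, hQy, mul_zero]

theorem existsUnique_map_add_smul_eq_zero_of_polarBilin_eq_zero [CharP F 2] [PerfectRing F 2]
    (hN : Q N ≠ 0) {x : V} (hx : Q.polarBilin N x = 0) : ∃! a : F, Q (x + a • N) = 0 := by
  have hline (a : F) : Q (x + a • N) = Q x + a ^ 2 * Q N := by
    rw [map_add_polarBilin, map_smul_sq, map_smul, polarBilin_comm, hx, smul_zero, add_zero]
  have hroot (a : F) : Q (x + a • N) = 0 ↔ a ^ 2 = Q x / Q N := by
    rw [hline, CharTwo.add_eq_zero, eq_div_iff hN, eq_comm]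
  simp only [hroot]
  exact (PerfectRing.bijective_frobenius (R := F) (p := 2)).existsUnique _

theorem existsUnique_map_add_smul_eq_zero_of_polarBilin_ne_zero {p x : V} (hp : Q p = 0)
    (hpx : Q.polarBilin p x ≠ 0) : ∃! a : F, Q (x + a • p) = 0 := by
  have hline (a : F) : Q (x + a • p) = Q x + a * Q.polarBilin p x := by
    rw [map_add_polarBilin, map_smul_sq, map_smul, polarBilin_comm, hp, mul_zero, add_zero,
      smul_eq_mul]
  refine ⟨-Q x / Q.polarBilin p x, ?_, fun a ha => ?_⟩
  · simp only [hline, div_mul_cancel₀ _ hpx, add_neg_cancel]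
  · rw [eq_div_iff hpx, eq_neg_iff_add_eq_zero, add_comm, ← hline, ha]

theorem existsUnique_polarBilin_add_smul_eq_zero {v w : V} (hwv : Q.polarBilin w v ≠ 0) (x : V) :
    ∃! a : F, Q.polarBilin w (x + a • v) = 0 := by
  have hline (a : F) : Q.polarBilin w (x + a • v) = Q.polarBilin w x + a * Q.polarBilin w v := by
    rw [map_add, map_smul, smul_eq_mul]
  refine ⟨-Q.polarBilin w x / Q.polarBilin w v, ?_, fun a ha => ?_⟩
  · simp only [hline, div_mul_cancel₀ _ hwv, add_neg_cancel]
  · rw [eq_div_iff hwv, eq_neg_iff_add_eq_zero, add_comm, ← hline, ha]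

end QuadraticForms

section VectorCounts

variable {F V : Type*} [Field F] [AddCommGroup V] [Module F V]

theorem ncard_mul_card_of_transversal {S T : Set V} {v : V} (hTS : T ⊆ S)
    (hS : ∀ x ∈ S, ∀ a : F, x + a • v ∈ S) (hT : ∀ x ∈ S, ∃! a : F, x + a • v ∈ T) :
    T.ncard * Nat.card F = S.ncard := by
  rw [← Nat.card_coe_set_eq, ← Nat.card_coe_set_eq, ← Nat.card_prod]
  refine Nat.card_congr (Equiv.ofBijective
    (fun z : T × F => (⟨z.1 + z.2 • v, hS _ (hTS z.1.2) _⟩ : S)) ⟨?_, ?_⟩)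
  · rintro ⟨⟨x, hx⟩, a⟩ ⟨⟨y, hy⟩, b⟩ h
    have hxy : x + a • v = y + b • v := congrArg Subtype.val h
    have hba : b - a = 0 := by
      refine (hT y (hTS hy)).unique ?_ (by rwa [zero_smul, add_zero])
      rwa [sub_smul, add_sub, ← hxy, add_sub_cancel_right]
    obtain rfl := sub_eq_zero.1 hba
    obtain rfl := add_right_cancel hxy
    rfl
  · rintro ⟨y, hy⟩
    obtain ⟨a, ha, -⟩ := hT y hy
    exact ⟨(⟨y + a • v, ha⟩, -a), Subtype.ext (by simp)⟩

theorem ncard_bilinForm_apply_eq [Module.Finite F V] {B : LinearMap.BilinForm F V}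
    (hB : B.Nondegenerate) {k : ℕ} {v : Fin k → V} (hv : LinearIndependent F v) (c : Fin k → F) :
    {x | ∀ i, B (v i) x = c i}.ncard = Nat.card F ^ (finrank F V - k) := by
  let L : V →ₗ[F] (Fin k → F) := LinearMap.pi fun i => B (v i)
  have hker : LinearMap.ker L = B.orthogonal (Submodule.span F (Set.range v)) := by
    ext x
    rw [LinearMap.mem_ker, LinearMap.BilinForm.mem_orthogonal_iff]
    refine ⟨fun hx w hw => ?_, fun hx => funext fun i => hx _ (Submodule.subset_span ⟨i, rfl⟩)⟩
    have hspan : Submodule.span F (Set.range v) ≤ LinearMap.ker (B.flip x) :=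
      Submodule.span_le.2 (Set.range_subset_iff.2 fun i => congrFun hx i)
    exact hspan hw
  have hrank : finrank F (LinearMap.ker L) = finrank F V - k := by
    rw [hker, LinearMap.BilinForm.finrank_orthogonal hB, finrank_span_eq_card hv, Fintype.card_fin]
  have hsurj : Function.Surjective L := by
    rw [← LinearMap.range_eq_top]
    apply Submodule.eq_top_of_finrank_eq
    have hrangeker := L.finrank_range_add_finrank_ker
    have hk : k ≤ finrank F V := by simpa using hv.fintype_card_le_finrank
    rw [finrank_fin_fun]
    omega
  have hfiber : {x | ∀ i, B (v i) x = c i} = L ⁻¹' {c} := by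
    ext x
    exact (funext_iff (f := L x) (g := c)).symm
  rw [hfiber, ← hrank, ← Module.natCard_eq_pow_finrank, ← Nat.card_coe_set_eq]
  exact Nat.card_congr (AddMonoidHom.fiberEquivKerOfSurjective (f := L.toAddMonoidHom) hsurj c)

theorem ncard_bilinForm_apply_eq_and_ne_zero [Finite F] [Module.Finite F V]
    {B : LinearMap.BilinForm F V}
    (hB : B.Nondegenerate) {k : ℕ} {v : Fin k → V} {r : V}
    (hrv : LinearIndependent F (Matrix.vecCons r v)) (c : Fin k → F) :
    {x | (∀ i, B (v i) x = c i) ∧ B r x ≠ 0}.ncard =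
      Nat.card F ^ (finrank F V - k) - Nat.card F ^ (finrank F V - (k + 1)) := by
  have hfinV : Finite V := Module.finite_of_finite F
  rw [← ncard_bilinForm_apply_eq hB (linearIndependent_finCons.1 hrv).1 c,
    ← ncard_bilinForm_apply_eq hB hrv (Matrix.vecCons 0 c), ← Set.ncard_sdiff]
  · congr 1
    ext x
    simp only [Set.mem_sdiff, Set.mem_ofPred_eq, Fin.forall_fin_succ, Matrix.cons_val_zero,
      Matrix.cons_val_succ]
    tauto
  · exact fun x hx i => by simpa using hx i.succ

end VectorCounts

section Points

variable {F V : Type*} [Field F] [AddCommGroup V] [Module F V] {Q : QuadraticForm F V}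
  {U W : Submodule F V} {p : ℙ F V}

theorem mk_mem_pointsOf {x : V} (hx : x ≠ 0) : Projectivization.mk F x hx ∈ pointsOf U ↔ x ∈ U := by
  change (Projectivization.mk F x hx).submodule ≤ U ↔ _
  rw [Projectivization.submodule_mk, Submodule.span_singleton_le_iff_mem]

theorem mem_pointsOf_iff_rep : p ∈ pointsOf U ↔ p.rep ∈ U := by
  conv_lhs => rw [← p.mk_rep]
  exact mk_mem_pointsOf _

theorem mk_mem_quadric {x : V} (hx : x ≠ 0) : Projectivization.mk F x hx ∈ quadric Q ↔ Q x = 0 := by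
  change (∀ y ∈ (Projectivization.mk F x hx).submodule, Q y = 0) ↔ _
  rw [Projectivization.submodule_mk]
  refine ⟨fun h => h x (Submodule.mem_span_singleton_self x), fun h y hy => ?_⟩
  obtain ⟨a, rfl⟩ := Submodule.mem_span_singleton.1 hy
  rw [map_smul_sq, h, mul_zero]

theorem mem_quadric_iff_rep : p ∈ quadric Q ↔ Q p.rep = 0 := by
  conv_lhs => rw [← p.mk_rep]
  exact mk_mem_quadric _

theorem pointsOf_subset_iff : pointsOf U ⊆ pointsOf W ↔ U ≤ W := by
  refine ⟨fun h x hx => ?_, fun h p hp => le_trans hp h⟩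
  obtain rfl | hx0 := eq_or_ne x 0
  · exact W.zero_mem
  · exact (mk_mem_pointsOf hx0).1 (h ((mk_mem_pointsOf hx0).2 hx))

theorem pointsOf_subset_quadric_iff : pointsOf U ⊆ quadric Q ↔ ∀ x ∈ U, Q x = 0 := by
  refine ⟨fun h x hx => ?_, fun h p hp => mem_quadric_iff_rep.2 (h _ (mem_pointsOf_iff_rep.1 hp))⟩
  obtain rfl | hx0 := eq_or_ne x 0
  · exact Q.map_zero
  · exact (mk_mem_quadric hx0).1 (h ((mk_mem_pointsOf hx0).2 hx))

theorem ncard_pointsOf (U : Submodule F V) : (pointsOf U).ncard = Nat.card (ℙ F U) := by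
  rw [← Nat.card_coe_set_eq]
  symm
  refine Nat.card_congr (Equiv.ofBijective
    (fun p : ℙ F U => (⟨p.map U.subtype U.subtype_injective, ?_⟩ : pointsOf U)) ⟨?_, ?_⟩)
  · induction p using Projectivization.ind with
    | h x hx => exact (mk_mem_pointsOf _).2 x.2
  · intro p p' h
    exact Projectivization.map_injective U.subtype U.subtype_injective (congrArg Subtype.val h)
  · rintro ⟨p, hp⟩
    have hrep : (⟨p.rep, mem_pointsOf_iff_rep.1 hp⟩ : U) ≠ 0 := fun h =>
      p.rep_nonzero (congrArg Subtype.val h)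
    exact ⟨Projectivization.mk F _ hrep, Subtype.ext p.mk_rep⟩

theorem ncard_pointsOf_of_finrank_two [Finite F] (hU : finrank F U = 2) :
    (pointsOf U).ncard = Nat.card F + 1 := by
  rw [ncard_pointsOf, Projectivization.card_of_finrank_two F U hU]

theorem ncard_pointsOf_of_finrank_one [Finite F] (hU : finrank F U = 1) :
    (pointsOf U).ncard = 1 := by
  rw [ncard_pointsOf, Projectivization.card_of_finrank F U hU, Finset.sum_range_one, pow_zero]

/-- The singular vectors of a totally isotropic subspace `U`: as `Q` is additive on `U`, they form
a subspace. -/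
def singularSubmodule (Q : QuadraticForm F V) (U : Submodule F V)
    (hU : ∀ x ∈ U, ∀ y ∈ U, Q.polarBilin x y = 0) : Submodule F V where
  carrier := {x | x ∈ U ∧ Q x = 0}
  zero_mem' := ⟨U.zero_mem, Q.map_zero⟩
  add_mem' := fun {x y} hx hy => ⟨U.add_mem hx.1 hy.1, by
    rw [map_add_polarBilin, hx.2, hy.2, hU x hx.1 y hy.1, add_zero, add_zero]⟩
  smul_mem' := fun a x hx => ⟨U.smul_mem a hx.1, by rw [map_smul_sq, hx.2, mul_zero]⟩

theorem pointsOf_inter_quadric (hU : ∀ x ∈ U, ∀ y ∈ U, Q.polarBilin x y = 0) :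
    pointsOf U ∩ quadric Q = pointsOf (singularSubmodule Q U hU) := by
  ext p
  rw [Set.mem_inter_iff, mem_pointsOf_iff_rep, mem_quadric_iff_rep, mem_pointsOf_iff_rep]
  rfl

theorem card_singularSubmodule_mul_card [Finite F] [CharP F 2]
    (hU : ∀ x ∈ U, ∀ y ∈ U, Q.polarBilin x y = 0) {x : V} (hx : x ∈ U) (hQx : Q x ≠ 0) :
    Nat.card (singularSubmodule Q U hU) * Nat.card F = Nat.card U := by
  change (singularSubmodule Q U hU : Set V).ncard * _ = (U : Set V).ncard
  refine ncard_mul_card_of_transversal (v := x) (fun y hy => hy.1)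
    (fun y hy a => U.add_mem hy (U.smul_mem a hx)) fun y hy => ?_
  obtain ⟨a, ha, ha_unique⟩ :=
    existsUnique_map_add_smul_eq_zero_of_polarBilin_eq_zero hQx (hU x hx y hy)
  exact ⟨a, ⟨U.add_mem hy (U.smul_mem a hx), ha⟩, fun b hb => ha_unique b hb.2⟩

theorem IsPolarLine.subset_quadric_or_ncard_inter_eq_one [Finite F] [CharP F 2]
    {l : Submodule F V} (hl : IsPolarLine Q.polarBilin l) :
    pointsOf l ⊆ quadric Q ∨ (pointsOf l ∩ quadric Q).ncard = 1 := by
  by_cases hsub : pointsOf l ⊆ quadric Q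
  · exact Or.inl hsub
  obtain ⟨x, hx, hQx⟩ : ∃ x ∈ l, Q x ≠ 0 := by
    simpa only [pointsOf_subset_quadric_iff, not_forall, exists_prop] using hsub
  have hl_finite : Module.Finite F l := Module.finite_of_finrank_pos (by rw [hl.1]; norm_num)
  have hK_finite : Module.Finite F (singularSubmodule Q l hl.2) :=
    Submodule.finiteDimensional_of_le fun y hy => hy.1
  have hcard := card_singularSubmodule_mul_card hl.2 hx hQx
  rw [Module.natCard_eq_pow_finrank (K := F) (V := singularSubmodule Q l hl.2),
    Module.natCard_eq_pow_finrank (K := F) (V := l), ← pow_succ] at hcard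
  have hrank := (Nat.pow_right_injective (Finite.one_lt_card (α := F)) hcard).trans hl.1
  rw [pointsOf_inter_quadric hl.2, ncard_pointsOf_of_finrank_one (Nat.succ_injective hrank)]
  exact Or.inr rfl

theorem exists_mk_of_notMem_ker {f : Dual F V} (hp : p ∉ pointsOf (LinearMap.ker f)) :
    ∃ (x : V) (hx : x ≠ 0), f x = 1 ∧ Projectivization.mk F x hx = p := by
  have hrep : f p.rep ≠ 0 := fun h => hp (mem_pointsOf_iff_rep.2 h)
  refine ⟨(f p.rep)⁻¹ • p.rep, smul_ne_zero (inv_ne_zero hrep) p.rep_nonzero, ?_, ?_⟩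
  · rw [map_smul, smul_eq_mul, inv_mul_cancel₀ hrep]
  · conv_rhs => rw [← p.mk_rep]
    rw [Projectivization.mk_eq_mk_iff']
    exact ⟨_, rfl⟩

theorem mk_inj_of_apply_eq_one {f : Dual F V} {x y : V} {hx : x ≠ 0} {hy : y ≠ 0}
    (hfx : f x = 1) (hfy : f y = 1)
    (h : Projectivization.mk F x hx = Projectivization.mk F y hy) : x = y := by
  obtain ⟨a, rfl⟩ := (Projectivization.mk_eq_mk_iff' F x y hx hy).1 h
  rw [map_smul, hfy, smul_eq_mul, mul_one] at hfx
  rw [hfx, one_smul]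

end Points

section SingularLines

variable {F V : Type*} [Field F] [AddCommGroup V] [Module F V] {Q : QuadraticForm F V} {N : V}

theorem linearIndependent_nucleus (hN : Q N ≠ 0) : LinearIndependent F ![N] :=
  LinearIndependent.of_subsingleton 0 (ne_zero_of_map_ne_zero hN)

theorem linearIndependent_nucleus_singular (hN : Q N ≠ 0) {x : V} (hx : x ≠ 0) (hQx : Q x = 0) :
    LinearIndependent F ![N, x] := by
  rw [LinearIndependent.pair_symm_iff, LinearIndependent.pair_iff' hx]
  rintro a rfl
  exact hN (by rw [map_smul_sq, hQx, mul_zero])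

theorem ncard_singular_mul_card [Finite F] [CharP F 2] [Module.Finite F V]
    (hB : Q.polarBilin.Nondegenerate) {k : ℕ} {v : Fin k → V} (hv : LinearIndependent F v)
    {j : Fin k} (hQj : Q (v j) ≠ 0) (hvj : ∀ i, Q.polarBilin (v i) (v j) = 0) :
    {x | Q x = 0 ∧ ∀ i, Q.polarBilin (v i) x = 0}.ncard * Nat.card F =
      Nat.card F ^ (finrank F V - k) := by
  have htranslate {x : V} (hx : ∀ i, Q.polarBilin (v i) x = 0) (a : F) (i : Fin k) :
      Q.polarBilin (v i) (x + a • v j) = 0 := by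
    rw [map_add, map_smul, hx, hvj, smul_zero, add_zero]
  rw [← ncard_bilinForm_apply_eq hB hv fun _ => 0]
  refine ncard_mul_card_of_transversal (v := v j) (fun x hx => hx.2) (fun x => htranslate)
    fun x hx => ?_
  obtain ⟨a, ha, ha_unique⟩ :=
    existsUnique_map_add_smul_eq_zero_of_polarBilin_eq_zero hQj (hx j)
  exact ⟨a, ⟨ha, htranslate hx a⟩, fun b hb => ha_unique b hb.1⟩

theorem ncard_singular [Finite F] [CharP F 2] (hV : finrank F V = 6)
    (hB : Q.polarBilin.Nondegenerate) (hN : Q N ≠ 0) :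
    {x | Q x = 0 ∧ Q.polarBilin N x = 0}.ncard = Nat.card F ^ 4 := by
  have hfin : Module.Finite F V := Module.finite_of_finrank_pos (by rw [hV]; norm_num)
  have hcount := ncard_singular_mul_card hB (linearIndependent_nucleus hN) (j := 0) hN
    (Fin.forall_fin_one.2 (polarBilin_self Q N))
  simp only [Fin.forall_fin_one, Matrix.cons_val_fin_one, hV] at hcount
  exact Nat.eq_of_mul_eq_mul_right Nat.card_pos hcount

theorem ncard_singular_perp [Finite F] [CharP F 2] (hV : finrank F V = 6)
    (hB : Q.polarBilin.Nondegenerate) (hN : Q N ≠ 0) {x : V} (hx : x ≠ 0) (hQx : Q x = 0)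
    (hNx : Q.polarBilin N x = 0) :
    {y | Q y = 0 ∧ Q.polarBilin N y = 0 ∧ Q.polarBilin x y = 0}.ncard = Nat.card F ^ 3 := by
  have hfin : Module.Finite F V := Module.finite_of_finrank_pos (by rw [hV]; norm_num)
  have hcount := ncard_singular_mul_card hB (linearIndependent_nucleus_singular hN hx hQx) (j := 0)
    hN (Fin.forall_fin_two.2 ⟨polarBilin_self Q N, (polarBilin_comm Q x N).trans hNx⟩)
  simp only [Fin.forall_fin_two, Matrix.cons_val_zero, Matrix.cons_val_one, hV] at hcount
  exact Nat.eq_of_mul_eq_mul_right Nat.card_pos hcount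

theorem linearIndependent_vecCons_of_apply_ne_zero {f : Dual F V} {x : V} {k : ℕ} {v : Fin k → V}
    (hv : LinearIndependent F v) (hfv : ∀ i, f (v i) = 0) (hfx : f x ≠ 0) :
    LinearIndependent F (Matrix.vecCons x v) :=
  linearIndependent_finCons.2 ⟨hv, fun h => hfx
    ((Submodule.span_le (p := LinearMap.ker f)).2 (Set.range_subset_iff.2 hfv) h)⟩

theorem linearIndependent_hyperbolic_pair [CharP F 2] {t t' : V} (ht : Q.polarBilin t t' ≠ 0)
    {k : ℕ} {v : Fin k → V} (hv : LinearIndependent F v) (htv : ∀ i, Q.polarBilin t (v i) = 0)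
    (htv' : ∀ i, Q.polarBilin t' (v i) = 0) :
    LinearIndependent F (Matrix.vecCons t (Matrix.vecCons t' v)) := by
  refine linearIndependent_vecCons_of_apply_ne_zero (f := Q.polarBilin t')
    (linearIndependent_vecCons_of_apply_ne_zero hv htv ht) ?_ (by rwa [polarBilin_comm])
  simpa only [Fin.forall_fin_succ, Matrix.cons_val_zero, Matrix.cons_val_succ, polarBilin_self,
    true_and] using htv'

theorem ncard_singular_hyperbolic_perp [Finite F] [CharP F 2] (hV : finrank F V = 6)
    (hB : Q.polarBilin.Nondegenerate) (hN : Q N ≠ 0) {t t' : V} (hNt : Q.polarBilin N t = 0)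
    (hNt' : Q.polarBilin N t' = 0) (ht : Q.polarBilin t t' ≠ 0) :
    {x | Q x = 0 ∧ Q.polarBilin t x = 0 ∧ Q.polarBilin t' x = 0 ∧ Q.polarBilin N x = 0}.ncard =
      Nat.card F ^ 2 := by
  have hfin : Module.Finite F V := Module.finite_of_finrank_pos (by rw [hV]; norm_num)
  rw [polarBilin_comm] at hNt hNt'
  have hLI : LinearIndependent F ![t, t', N] :=
    linearIndependent_hyperbolic_pair ht (linearIndependent_nucleus hN)
      (Fin.forall_fin_one.2 hNt) (Fin.forall_fin_one.2 hNt')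
  have hcount := ncard_singular_mul_card hB hLI (j := 2) hN (by
    simp only [Fin.forall_fin_succ, IsEmpty.forall_iff, and_true]
    exact ⟨hNt, hNt', polarBilin_self Q N⟩)
  simp only [Fin.forall_fin_succ, Matrix.cons_val_zero, Matrix.cons_val_succ, hV,
    IsEmpty.forall_iff, and_true] at hcount
  exact Nat.eq_of_mul_eq_mul_right Nat.card_pos hcount

theorem ncard_span_singleton {x : V} (hx : x ≠ 0) :
    (Submodule.span F {x} : Set V).ncard = Nat.card F := by
  rw [← Nat.card_coe_set_eq]
  exact (Nat.card_congr (LinearEquiv.toSpanNonzeroSingleton F V x hx).toEquiv).symm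

theorem ncard_singular_perp_diff_span [Finite F] [CharP F 2] (hV : finrank F V = 6)
    (hB : Q.polarBilin.Nondegenerate) (hN : Q N ≠ 0) {x : V} (hx : x ≠ 0) (hQx : Q x = 0)
    (hNx : Q.polarBilin N x = 0) :
    ({y | Q y = 0 ∧ Q.polarBilin N y = 0 ∧ Q.polarBilin x y = 0} \
      (Submodule.span F {x} : Set V)).ncard = Nat.card F ^ 3 - Nat.card F := by
  have hfin : Module.Finite F V := Module.finite_of_finrank_pos (by rw [hV]; norm_num)
  have hfinV : Finite V := Module.finite_of_finite F
  rw [Set.ncard_sdiff, ncard_singular_perp hV hB hN hx hQx hNx, ncard_span_singleton hx]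
  intro y hy
  obtain ⟨a, rfl⟩ := Submodule.mem_span_singleton.1 hy
  refine ⟨?_, ?_, ?_⟩
  · rw [map_smul_sq, hQx, mul_zero]
  · rw [map_smul, hNx, smul_zero]
  · rw [map_smul, polarBilin_self, smul_zero]

theorem ncard_setOf_fin_two {α : Type*} [Finite α] {X : Set α} {Y : α → Set α} {m : ℕ}
    (hY : ∀ x ∈ X, (Y x).ncard = m) :
    {s : Fin 2 → α | s 0 ∈ X ∧ s 1 ∈ Y (s 0)}.ncard = X.ncard * m := by
  have e : {s : Fin 2 → α | s 0 ∈ X ∧ s 1 ∈ Y (s 0)} ≃ Σ x : X, Y x :=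
    { toFun := fun s => ⟨⟨s.1 0, s.2.1⟩, ⟨s.1 1, s.2.2⟩⟩
      invFun := fun z => ⟨![z.1, z.2], z.1.2, z.2.2⟩
      left_inv := fun s => Subtype.ext (FinVec.etaExpand_eq s.1)
      right_inv := fun _ => rfl }
  have := Fintype.ofFinite X
  simp only [← Nat.card_coe_set_eq] at hY ⊢
  rw [Nat.card_congr e, Nat.card_sigma, Finset.sum_congr rfl fun (x : X) _ => hY x x.2,
    Finset.sum_const, Finset.card_univ, smul_eq_mul, Nat.card_eq_fintype_card]

theorem ncard_linearIndependent_span_mem [Finite F] [Finite V] {k : ℕ} {L : Set (Submodule F V)}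
    (hL : ∀ l ∈ L, finrank F l = k) :
    {s : Fin k → V | LinearIndependent F s ∧ Submodule.span F (Set.range s) ∈ L}.ncard =
      L.ncard * ∏ i : Fin k, (Nat.card F ^ k - Nat.card F ^ (i : ℕ)) := by
  have hspan (l : L) (s : {s : Fin k → l.1 // LinearIndependent F s}) :
      Submodule.span F (Set.range fun i => (s.1 i : V)) = l.1 := by
    apply Submodule.eq_of_le_of_finrank_eq
    · exact Submodule.span_le.2 (Set.range_subset_iff.2 fun i => (s.1 i).2)
    · have hs := s.2.map' l.1.subtype (Submodule.ker_subtype _)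
      rw [hL l l.2]
      exact (finrank_span_eq_card hs).trans (Fintype.card_fin k)
  have e : (Σ l : L, {s : Fin k → l.1 // LinearIndependent F s}) ≃
      {s : Fin k → V | LinearIndependent F s ∧ Submodule.span F (Set.range s) ∈ L} := by
    refine Equiv.ofBijective (fun z => ⟨fun i => z.2.1 i,
      z.2.2.map' z.1.1.subtype (Submodule.ker_subtype _), (hspan z.1 z.2).symm ▸ z.1.2⟩) ⟨?_, ?_⟩
    · rintro ⟨l, s⟩ ⟨l', s'⟩ h
      have hs : (fun i => (s.1 i : V)) = fun i => (s'.1 i : V) := congrArg Subtype.val h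
      obtain rfl : l = l' := Subtype.ext (by rw [← hspan l s, hs, hspan l' s'])
      obtain rfl : s = s' := Subtype.ext (funext fun i => Subtype.ext (congrFun hs i))
      rfl
    · rintro ⟨s, hs, hsL⟩
      exact ⟨⟨⟨_, hsL⟩, ⟨fun i => ⟨s i, Submodule.subset_span ⟨i, rfl⟩⟩,
        LinearIndependent.of_comp (Submodule.subtype _) hs⟩⟩, rfl⟩
  have hframes (l : L) : Nat.card {s : Fin k → l.1 // LinearIndependent F s} =
      ∏ i : Fin k, (Nat.card F ^ k - Nat.card F ^ (i : ℕ)) := by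
    have := Fintype.ofFinite F
    rw [card_linearIndependent (hL l l.2).ge, hL l l.2, ← Nat.card_eq_fintype_card]
  have := Fintype.ofFinite L
  rw [← Nat.card_coe_set_eq, ← Nat.card_congr e, Nat.card_sigma, Finset.sum_congr rfl fun l _ =>
    hframes l, Finset.sum_const, Finset.card_univ, smul_eq_mul, ← Nat.card_eq_fintype_card,
    Nat.card_coe_set_eq]

theorem pointsOf_subset_baseLocus_iff {U : Submodule F V} :
    pointsOf U ⊆ baseLocus Q N ↔ ∀ x ∈ U, Q x = 0 ∧ Q.polarBilin N x = 0 := by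
  rw [baseLocus, Set.subset_inter_iff, pointsOf_subset_quadric_iff, pointsOf_subset_iff]
  exact ⟨fun h x hx => ⟨h.1 x hx, h.2 hx⟩,
    fun h => ⟨fun x hx => (h x hx).1, fun x hx => (h x hx).2⟩⟩

theorem linearIndependent_and_span_mem_singularLines_iff [CharP F 2] (s : Fin 2 → V) :
    (LinearIndependent F s ∧ Submodule.span F (Set.range s) ∈
      {l | IsPolarLine Q.polarBilin l ∧ pointsOf l ⊆ baseLocus Q N}) ↔
    s 0 ∈ {x | Q x = 0 ∧ Q.polarBilin N x = 0} \ {0} ∧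
      s 1 ∈ {y | Q y = 0 ∧ Q.polarBilin N y = 0 ∧ Q.polarBilin (s 0) y = 0} \
        (Submodule.span F {s 0} : Set V) := by
  have heta : ![s 0, s 1] = s := FinVec.etaExpand_eq s
  have hmem (i : Fin 2) : s i ∈ Submodule.span F (Set.range s) := Submodule.subset_span ⟨i, rfl⟩
  simp only [Set.mem_ofPred_eq, pointsOf_subset_baseLocus_iff]
  constructor
  · rintro ⟨hs, ⟨-, hiso⟩, hsing⟩
    refine ⟨⟨hsing _ (hmem 0), hs.ne_zero 0⟩, ⟨(hsing _ (hmem 1)).1, (hsing _ (hmem 1)).2,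
      hiso _ (hmem 0) _ (hmem 1)⟩, fun h => ?_⟩
    obtain ⟨a, ha⟩ := Submodule.mem_span_singleton.1 h
    exact (LinearIndependent.pair_iff' (hs.ne_zero 0)).1 (by rwa [heta]) a ha
  · rintro ⟨⟨⟨hQ0, hN0⟩, hne⟩, ⟨hQ1, hN1, h01⟩, hspan⟩
    have hs : LinearIndependent F s := by
      rw [← heta, LinearIndependent.pair_iff' hne]
      exact fun a ha => hspan (Submodule.mem_span_singleton.2 ⟨a, ha⟩)
    have hpair : ∀ z ∈ Set.range s, ∀ w ∈ Set.range s, Q.polarBilin z w = 0 := by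
      simp only [Set.forall_mem_range, Fin.forall_fin_two, polarBilin_self, h01,
        polarBilin_comm Q (s 1) (s 0), and_self]
    refine ⟨hs, ⟨by rw [finrank_span_eq_card hs, Fintype.card_fin], fun x hx y hy => ?_⟩,
      fun x hx => ⟨map_eq_zero_of_mem_span ?_ hpair hx, ?_⟩⟩
    · refine polarBilin_eq_zero_of_mem_span (fun z hz => ?_) hx
      rw [polarBilin_comm]
      exact polarBilin_eq_zero_of_mem_span (fun w hw => hpair w hw z hz) hy
    · simp only [Set.forall_mem_range, Fin.forall_fin_two, hQ0, hQ1, and_self]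
    · rw [polarBilin_comm]
      refine polarBilin_eq_zero_of_mem_span ?_ hx
      simp only [Set.forall_mem_range, Fin.forall_fin_two, polarBilin_comm Q _ N, hN0, hN1,
        and_self]

theorem ncard_singularLines [Finite F] [CharP F 2] (hV : finrank F V = 6)
    (hB : Q.polarBilin.Nondegenerate) (hN : Q N ≠ 0) :
    {l | IsPolarLine Q.polarBilin l ∧ pointsOf l ⊆ baseLocus Q N}.ncard =
      (Nat.card F + 1) * (Nat.card F ^ 2 + 1) := by
  have hfin : Module.Finite F V := Module.finite_of_finrank_pos (by rw [hV]; norm_num)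
  have hfinV : Finite V := Module.finite_of_finite F
  have hframes := ncard_linearIndependent_span_mem (F := F) (V := V) (k := 2)
    (L := {l | IsPolarLine Q.polarBilin l ∧ pointsOf l ⊆ baseLocus Q N}) fun l hl => hl.1.1
  simp only [linearIndependent_and_span_mem_singularLines_iff] at hframes
  rw [ncard_setOf_fin_two (X := {x | Q x = 0 ∧ Q.polarBilin N x = 0} \ {0})
      (Y := fun x => {y | Q y = 0 ∧ Q.polarBilin N y = 0 ∧ Q.polarBilin x y = 0} \
        (Submodule.span F {x} : Set V))
      fun x hx => ncard_singular_perp_diff_span hV hB hN hx.2 hx.1.1 hx.1.2,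
    Set.ncard_sdiff_singleton_of_mem (by exact ⟨Q.map_zero, map_zero _⟩), ncard_singular hV hB hN,
    Fin.prod_univ_two, Fin.val_zero, Fin.val_one, pow_zero, pow_one] at hframes
  have hq : 1 < Nat.card F := Finite.one_lt_card
  have h2 : Nat.card F < Nat.card F ^ 2 := by nlinarith
  have h3 : Nat.card F < Nat.card F ^ 3 := by nlinarith
  have h4 : 1 < Nat.card F ^ 4 := by nlinarith
  refine Nat.eq_of_mul_eq_mul_right
    (Nat.mul_pos (Nat.sub_pos_of_lt (hq.trans h2)) (Nat.sub_pos_of_lt h2)) ?_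
  rw [← hframes]
  zify [h2.le, h3.le, h4.le, (hq.trans h2).le]
  ring

end SingularLines

section EllipticQuadrics

variable {F V : Type*} [Field F] [AddCommGroup V] [Module F V] {Q : QuadraticForm F V} {N : V}

/-- The affine part of the quadric `Q` with respect to the hyperplane `N^⊥`: each point of the
quadric off `N^⊥` has exactly one representative `x` with `B(N, x) = 1`. -/
def affineQuadric (Q : QuadraticForm F V) (N : V) : Set V :=
  {x | Q x = 0 ∧ Q.polarBilin N x = 1}

theorem add_smul_mem_affineQuadric {x t : V} (hx : x ∈ affineQuadric Q N) (ht : Q t = 0)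
    (hNt : Q.polarBilin N t = 0) (hxt : Q.polarBilin t x = 0) (a : F) :
    x + a • t ∈ affineQuadric Q N := by
  constructor
  · rw [map_add_polarBilin, map_smul_sq, map_smul, polarBilin_comm, hx.1, ht, hxt, mul_zero,
      smul_zero, add_zero, add_zero]
  · rw [map_add, map_smul, hx.2, hNt, smul_zero, add_zero]

theorem ncard_singular_of_forall_polarBilin_ne_zero {S : Set V} {p : V} (hp : Q p = 0)
    (hS : ∀ x ∈ S, ∀ a : F, x + a • p ∈ S) (hpS : ∀ x ∈ S, Q.polarBilin p x ≠ 0) :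
    {x | Q x = 0 ∧ x ∈ S}.ncard * Nat.card F = S.ncard := by
  refine ncard_mul_card_of_transversal (v := p) (fun x hx => hx.2) hS fun x hx => ?_
  obtain ⟨a, ha, ha_unique⟩ := existsUnique_map_add_smul_eq_zero_of_polarBilin_ne_zero hp (hpS x hx)
  exact ⟨a, ⟨ha, hS x hx a⟩, fun b hb => ha_unique b hb.1⟩

theorem IsElliptic.not_forall_polarBilin_eq_zero (hQ : IsElliptic Q) {v : Fin 3 → V}
    (hv : LinearIndependent F v) (hQv : ∀ i, Q (v i) = 0) :
    ¬ ∀ i j, Q.polarBilin (v i) (v j) = 0 := fun hvv =>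
  hQ.2 ⟨Submodule.span F (Set.range v), by rw [finrank_span_eq_card hv, Fintype.card_fin],
    fun _ hx => map_eq_zero_of_mem_span (Set.forall_mem_range.2 hQv)
      (by simpa only [Set.forall_mem_range] using hvv) hx⟩

variable [CharP F 2] {t t' : V}

theorem exists_singular_hyperbolic_perp [Finite F] (hV : finrank F V = 6)
    (hB : Q.polarBilin.Nondegenerate) (hN : Q N ≠ 0) (hNt : Q.polarBilin N t = 0)
    (hNt' : Q.polarBilin N t' = 0) (htt' : Q.polarBilin t t' ≠ 0) :
    ∃ r, r ≠ 0 ∧ Q r = 0 ∧ Q.polarBilin N r = 0 ∧ Q.polarBilin t r = 0 ∧ Q.polarBilin t' r = 0 := by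
  have hcount := ncard_singular_hyperbolic_perp hV hB hN hNt hNt' htt'
  have hq : 1 < Nat.card F ^ 2 := Nat.one_lt_pow two_ne_zero Finite.one_lt_card
  obtain ⟨r, ⟨hQr, htr, htr', hNr⟩, hr⟩ := Set.exists_ne_of_one_lt_ncard (hcount ▸ hq) 0
  exact ⟨r, hr, hQr, hNr, htr, htr'⟩

/-- Otherwise `x`, `t` and `r` would span a totally singular plane. -/
theorem IsElliptic.polarBilin_ne_zero_of_mem_affineQuadric (hQ : IsElliptic Q) {r : V}
    (htr_li : LinearIndependent F ![t, r]) (hQt : Q t = 0) (hQr : Q r = 0)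
    (hNt : Q.polarBilin N t = 0) (hNr : Q.polarBilin N r = 0) (htr : Q.polarBilin t r = 0) {x : V}
    (hx : x ∈ affineQuadric Q N) (htx : Q.polarBilin t x = 0) : Q.polarBilin r x ≠ 0 := by
  intro hrx
  have hxtr_li : LinearIndependent F ![x, t, r] :=
    linearIndependent_vecCons_of_apply_ne_zero (f := Q.polarBilin N) htr_li
      (Fin.forall_fin_two.2 ⟨hNt, hNr⟩) (by rw [hx.2]; exact one_ne_zero)
  refine hQ.not_forall_polarBilin_eq_zero hxtr_li ?_ ?_ <;>
    simp only [Fin.forall_fin_succ, IsEmpty.forall_iff, and_true, Matrix.cons_val_zero,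
      Matrix.cons_val_succ]
  · exact ⟨hx.1, hQt, hQr⟩
  · simp only [polarBilin_self, polarBilin_comm Q x, polarBilin_comm Q r t, htx, hrx, htr, and_self]

/-- The vectors of the affine quadric orthogonal to `t` and `t'` are not orthogonal to some further
singular vector `r`, so the translates by multiples of `r` of each vector of the relevant affine
subspace contain exactly one of them. -/
theorem IsElliptic.ncard_affineQuadric_perp_perp [Finite F] (hQ : IsElliptic Q)
    (hV : finrank F V = 6) (hN : Q N ≠ 0) (hQt : Q t = 0) (hNt : Q.polarBilin N t = 0)
    (hNt' : Q.polarBilin N t' = 0) (htt' : Q.polarBilin t t' ≠ 0) :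
    {x ∈ affineQuadric Q N | Q.polarBilin t x = 0 ∧ Q.polarBilin t' x = 0}.ncard =
      (Nat.card F - 1) * Nat.card F := by
  have hfin : Module.Finite F V := Module.finite_of_finrank_pos (by rw [hV]; norm_num)
  obtain ⟨r, hr, hQr, hNr, htr, htr'⟩ := exists_singular_hyperbolic_perp hV hQ.1 hN hNt hNt' htt'
  let S : Set V :=
    {x | (∀ i, Q.polarBilin (![t, t', N] i) x = (![0, 0, 1] : Fin 3 → F) i) ∧ Q.polarBilin r x ≠ 0}
  have hmemS (x : V) : x ∈ S ↔ (Q.polarBilin t x = 0 ∧ Q.polarBilin t' x = 0 ∧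
      Q.polarBilin N x = 1) ∧ Q.polarBilin r x ≠ 0 := by
    simp only [S, Set.mem_ofPred_eq, Fin.forall_fin_succ, IsEmpty.forall_iff, and_true,
      Matrix.cons_val_zero, Matrix.cons_val_succ]
  have htr_li : LinearIndependent F ![t, r] :=
    linearIndependent_vecCons_of_apply_ne_zero (f := Q.polarBilin t')
      (LinearIndependent.of_subsingleton 0 hr) (Fin.forall_fin_one.2 htr')
      (by rwa [polarBilin_comm])
  have hS : S.ncard = Nat.card F ^ 3 - Nat.card F ^ 2 := by
    have hLI : LinearIndependent F ![r, t, t', N] := by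
      have htt'rN : LinearIndependent F ![t, t', r, N] :=
        linearIndependent_hyperbolic_pair htt'
          (LinearIndependent.pair_symm_iff.1 (linearIndependent_nucleus_singular hN hr hQr))
          (Fin.forall_fin_two.2 ⟨htr, by rwa [polarBilin_comm]⟩)
          (Fin.forall_fin_two.2 ⟨htr', by rwa [polarBilin_comm]⟩)
      have hperm : ![t, t', r, N] ∘ ![2, 0, 1, 3] = ![r, t, t', N] :=
        (FinVec.etaExpand_eq _).symm
      exact hperm ▸ htt'rN.comp ![2, 0, 1, 3] (by decide)
    rw [ncard_bilinForm_apply_eq_and_ne_zero hQ.1 hLI, hV]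
  have hsingular : {x ∈ affineQuadric Q N | Q.polarBilin t x = 0 ∧ Q.polarBilin t' x = 0} =
      {x | Q x = 0 ∧ x ∈ S} := by
    ext x
    rw [Set.mem_ofPred_eq, Set.mem_ofPred_eq, hmemS]
    refine ⟨fun ⟨hx, htx, htx'⟩ => ⟨hx.1, ⟨htx, htx', hx.2⟩, ?_⟩,
      fun ⟨hQx, ⟨htx, htx', hNx⟩, _⟩ => ⟨⟨hQx, hNx⟩, htx, htx'⟩⟩
    exact hQ.polarBilin_ne_zero_of_mem_affineQuadric htr_li hQt hQr hNt hNr htr hx htx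
  have htransversal := ncard_singular_of_forall_polarBilin_ne_zero (S := S) hQr
    (fun x hx a => by
      rw [hmemS] at hx ⊢
      simpa only [map_add, map_smul, htr, htr', hNr, polarBilin_self, smul_zero, add_zero] using hx)
    fun x hx => hx.2
  rw [hsingular]
  refine Nat.eq_of_mul_eq_mul_right (Nat.card_pos (α := F)) ?_
  rw [htransversal, hS, mul_assoc, Nat.sub_mul, one_mul, ← sq, ← pow_succ']

theorem IsElliptic.ncard_affineQuadric_perp [Finite F] (hQ : IsElliptic Q)
    (hV : finrank F V = 6) (hN : Q N ≠ 0) (hQt : Q t = 0) (hNt : Q.polarBilin N t = 0)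
    (hNt' : Q.polarBilin N t' = 0) (htt' : Q.polarBilin t t' ≠ 0) :
    {x ∈ affineQuadric Q N | Q.polarBilin t x = 0}.ncard = (Nat.card F - 1) * Nat.card F ^ 2 := by
  have htt'_comm : Q.polarBilin t' t ≠ 0 := by rwa [polarBilin_comm]
  have htranslate {x : V} (hx : x ∈ affineQuadric Q N ∧ Q.polarBilin t x = 0) (a : F) :
      x + a • t ∈ affineQuadric Q N ∧ Q.polarBilin t (x + a • t) = 0 :=
    ⟨add_smul_mem_affineQuadric hx.1 hQt hNt hx.2 a, by
      rw [map_add, map_smul, hx.2, polarBilin_self, smul_zero, add_zero]⟩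
  rw [sq, ← mul_assoc, ← hQ.ncard_affineQuadric_perp_perp hV hN hQt hNt hNt' htt']
  refine (ncard_mul_card_of_transversal
    (S := {x ∈ affineQuadric Q N | Q.polarBilin t x = 0}) (v := t) (fun x hx => ⟨hx.1, hx.2.1⟩)
    (fun x hx => htranslate hx) fun x hx => ?_).symm
  obtain ⟨a, ha, ha_unique⟩ := existsUnique_polarBilin_add_smul_eq_zero htt'_comm x
  exact ⟨a, ⟨(htranslate hx a).1, (htranslate hx a).2, ha⟩, fun b hb => ha_unique b hb.2.2⟩

theorem ncard_affineQuadric_notPerp [Finite F] (hV : finrank F V = 6)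
    (hB : Q.polarBilin.Nondegenerate) (hN : Q N ≠ 0) (ht : t ≠ 0) (hQt : Q t = 0)
    (hNt : Q.polarBilin N t = 0) :
    {x ∈ affineQuadric Q N | Q.polarBilin t x ≠ 0}.ncard = (Nat.card F - 1) * Nat.card F ^ 3 := by
  have hfin : Module.Finite F V := Module.finite_of_finrank_pos (by rw [hV]; norm_num)
  have hLI : LinearIndependent F ![t, N] :=
    LinearIndependent.pair_symm_iff.1 (linearIndependent_nucleus_singular hN ht hQt)
  have hS := ncard_bilinForm_apply_eq_and_ne_zero hB hLI ![1]
  have htransversal := ncard_singular_of_forall_polarBilin_ne_zero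
    (S := {x | Q.polarBilin N x = 1 ∧ Q.polarBilin t x ≠ 0}) hQt
    (fun x hx a => by
      simpa only [Set.mem_ofPred_eq, map_add, map_smul, hNt, polarBilin_self, smul_zero, add_zero]
        using hx)
    fun x hx => hx.2
  simp only [Fin.forall_fin_one, Matrix.cons_val_fin_one, hV] at hS
  simp only [affineQuadric, Set.mem_ofPred_eq, and_assoc] at htransversal ⊢
  refine Nat.eq_of_mul_eq_mul_right (Nat.card_pos (α := F)) ?_
  rw [htransversal, hS, mul_assoc, Nat.sub_mul, one_mul, ← pow_succ, ← pow_succ']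

theorem IsElliptic.ncard_affineQuadric [Finite F] (hQ : IsElliptic Q)
    (hV : finrank F V = 6) (hN : Q N ≠ 0) (hQt : Q t = 0) (hNt : Q.polarBilin N t = 0)
    (hNt' : Q.polarBilin N t' = 0) (htt' : Q.polarBilin t t' ≠ 0) :
    (affineQuadric Q N).ncard = (Nat.card F - 1) * Nat.card F ^ 2 * (Nat.card F + 1) := by
  have hfin : Module.Finite F V := Module.finite_of_finrank_pos (by rw [hV]; norm_num)
  have hfinV : Finite V := Module.finite_of_finite F
  have ht : t ≠ 0 := by
    rintro rfl
    exact htt' (LinearMap.map_zero₂ _ _)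
  rw [← Set.ncard_inter_add_ncard_sdiff_eq_ncard (affineQuadric Q N) {x | Q.polarBilin t x = 0}
    (Set.toFinite _)]
  have hperp := hQ.ncard_affineQuadric_perp hV hN hQt hNt hNt' htt'
  have hnotPerp := ncard_affineQuadric_notPerp hV hQ.1 hN ht hQt hNt
  exact (congrArg₂ (· + ·) hperp hnotPerp).trans (by ring)

end EllipticQuadrics

section Incidence

variable {α ι : Type*} [Fintype ι] {R : ι → α → Prop} [∀ i, DecidablePred (R i)]
  {S X A C : Finset α}

/-- The number of blocks incident with `x`. -/
def incidenceDegree (R : ι → α → Prop) [∀ i, DecidablePred (R i)] (x : α) : ℕ :=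
  (Finset.univ.filter fun i => R i x).card

theorem sum_incidenceDegree (R : ι → α → Prop) [∀ i, DecidablePred (R i)] (S : Finset α) :
    ∑ x ∈ S, incidenceDegree R x = ∑ i, (S.filter (R i)).card :=
  Finset.sum_card_bipartiteAbove_eq_sum_card_bipartiteBelow fun x i => R i x

theorem incidenceDegree_sq (R : ι → α → Prop) [∀ i, DecidablePred (R i)] (x : α) :
    incidenceDegree R x ^ 2 = incidenceDegree (fun (p : ι × ι) x => R p.1 x ∧ R p.2 x) x := by
  rw [incidenceDegree, sq, ← Finset.card_product, ← Finset.filter_product, Finset.univ_product_univ,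
    incidenceDegree]

theorem sum_incidenceDegree_of_forall_card {c : ℤ} (hc : ∀ i, ((S.filter (R i)).card : ℤ) = c) :
    ∑ x ∈ S, (incidenceDegree R x : ℤ) = Fintype.card ι * c := by
  rw [← Nat.cast_sum, sum_incidenceDegree, Nat.cast_sum, Finset.sum_congr rfl fun i _ => hc i,
    Finset.sum_const, Finset.card_univ, nsmul_eq_mul]

theorem sum_sq_incidenceDegree_of_forall_card {c₁ c₂ : ℤ}
    (hc₁ : ∀ i, ((S.filter (R i)).card : ℤ) = c₁)
    (hc₂ : ∀ i j, i ≠ j → ((S.filter fun x => R i x ∧ R j x).card : ℤ) = c₂) :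
    ∑ x ∈ S, (incidenceDegree R x : ℤ) ^ 2 =
      Fintype.card ι * (c₁ + (Fintype.card ι - 1) * c₂) := by
  classical
  have hrow (i : ι) : ∑ j, ((S.filter fun x => R i x ∧ R j x).card : ℤ) =
      c₁ + (Fintype.card ι - 1) * c₂ := by
    have hne : ∀ j ∈ Finset.univ.erase i, ((S.filter fun x => R i x ∧ R j x).card : ℤ) = c₂ :=
      fun j hj => hc₂ i j (Finset.ne_of_mem_erase hj).symm
    rw [← Finset.add_sum_erase _ _ (Finset.mem_univ i), Finset.sum_congr rfl hne, Finset.sum_const,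
      nsmul_eq_mul, Finset.cast_card_erase_of_mem (Finset.mem_univ i), Finset.card_univ]
    simp only [and_self, hc₁]
  calc ∑ x ∈ S, (incidenceDegree R x : ℤ) ^ 2
      = ∑ i, ∑ j, ((S.filter fun x => R i x ∧ R j x).card : ℤ) := by
        simp only [← Nat.cast_pow, incidenceDegree_sq, ← Nat.cast_sum, sum_incidenceDegree,
          Fintype.sum_prod_type]
    _ = Fintype.card ι * (c₁ + (Fintype.card ι - 1) * c₂) := by
        rw [Finset.sum_congr rfl fun i _ => hrow i, Finset.sum_const, Finset.card_univ,
          nsmul_eq_mul]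

theorem sum_incidenceDegree_sub_sq_of_forall_card {c₁ c₂ : ℤ}
    (hc₁ : ∀ i, ((S.filter (R i)).card : ℤ) = c₁)
    (hc₂ : ∀ i j, i ≠ j → ((S.filter fun x => R i x ∧ R j x).card : ℤ) = c₂) (a : ℤ) :
    ∑ x ∈ S, ((incidenceDegree R x : ℤ) - a) ^ 2 =
      Fintype.card ι * (c₁ + (Fintype.card ι - 1) * c₂) - 2 * a * (Fintype.card ι * c₁) +
        S.card * a ^ 2 := by
  have hexpand : ∀ x ∈ S, ((incidenceDegree R x : ℤ) - a) ^ 2 =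
      (incidenceDegree R x : ℤ) ^ 2 - 2 * a * incidenceDegree R x + a ^ 2 := fun x _ => by ring
  rw [Finset.sum_congr rfl hexpand, Finset.sum_add_distrib, Finset.sum_sub_distrib,
    ← Finset.mul_sum, sum_incidenceDegree_of_forall_card hc₁,
    sum_sq_incidenceDegree_of_forall_card hc₁ hc₂, Finset.sum_const, nsmul_eq_mul]

theorem eq_of_sum_sub_sq_eq {f : α → ℤ} {a : ℤ} (hAX : A ⊆ X)
    (hsum : ∑ x ∈ A, (f x - a) ^ 2 = ∑ x ∈ X, (f x - a) ^ 2) {x : α} (hx : x ∈ X) (hxA : x ∉ A) :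
    f x = a := by
  classical
  have hcompl : ∑ x ∈ X \ A, (f x - a) ^ 2 = 0 := by
    rwa [← Finset.sum_sdiff hAX, right_eq_add] at hsum
  have hzero := (Finset.sum_eq_zero_iff_of_nonneg fun x _ => sq_nonneg _).1 hcompl x
    (Finset.mem_sdiff.2 ⟨hx, hxA⟩)
  exact sub_eq_zero.1 ((pow_eq_zero_iff two_ne_zero).1 hzero)

/-- The parameters of the incidence structure that has the affine part of an elliptic quadric as
point set `X` and whose blocks are the hyperplane sections of `X` by the `P^⊥`, for `P` in an ovoid
of the parabolic quadric at infinity. -/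
structure HasOvoidParameters (R : ι → α → Prop) [∀ i, DecidablePred (R i)] (X : Finset α) (q : ℤ) :
    Prop where
  card_index : (Fintype.card ι : ℤ) = q ^ 2 + 1
  card_points : (X.card : ℤ) = (q - 1) * q ^ 2 * (q + 1)
  card_block (i : ι) : ((X.filter (R i)).card : ℤ) = (q - 1) * q ^ 2
  card_block_inter (i j : ι) : i ≠ j → ((X.filter fun x => R i x ∧ R j x).card : ℤ) = (q - 1) * q

variable {q s : ℤ}

theorem HasOvoidParameters.sum_incidenceDegree_sub_sq (h : HasOvoidParameters R X q) (a : ℤ) :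
    ∑ x ∈ X, ((incidenceDegree R x : ℤ) - a) ^ 2 =
      (q - 1) * q ^ 2 * ((q + 1) * (q ^ 2 + 1 + a ^ 2) - 2 * a * (q ^ 2 + 1)) := by
  rw [sum_incidenceDegree_sub_sq_of_forall_card h.card_block h.card_block_inter, h.card_index,
    h.card_points]
  ring

theorem four_mul_lt_of_sq_eq_two_mul (hq : 8 ≤ q) (hs : s ^ 2 = 2 * q) :
    4 * q < (q + 1 - s) * (q + 1) := by
  rcases le_or_gt s 0 with hs_nonpos | hs_pos
  · nlinarith
  · have hs_four : 4 ≤ s := by nlinarith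
    have : (0 : ℤ) ≤ (s - 4) * s ^ 3 := mul_nonneg (by lia) (by positivity)
    nlinarith

/-- Points of degree `0` contribute `(q + 1)²` each to the second moment about `q + 1`, so there
are not many of them. -/
theorem HasOvoidParameters.not_forall_incidenceDegree_eq_zero (h : HasOvoidParameters R X q)
    (hq : 8 ≤ q) (hs : s ^ 2 = 2 * q) (hCX : C ⊆ X)
    (hC : 2 * (C.card : ℤ) = (q - 1) * q ^ 2 * (q + 1 - s)) :
    ¬ ∀ x ∈ C, incidenceDegree R x = 0 := by
  intro hzero
  have hmoment : (C.card : ℤ) * (q + 1) ^ 2 ≤ (q - 1) * q ^ 2 * ((q + 1) * (2 * q)) :=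
    calc (C.card : ℤ) * (q + 1) ^ 2
        = ∑ x ∈ C, ((incidenceDegree R x : ℤ) - (q + 1)) ^ 2 := by
          rw [Finset.sum_congr rfl (g := fun _ => (q + 1) ^ 2) fun x hx => by
            rw [hzero x hx, Nat.cast_zero, zero_sub, neg_sq], Finset.sum_const, nsmul_eq_mul]
      _ ≤ ∑ x ∈ X, ((incidenceDegree R x : ℤ) - (q + 1)) ^ 2 :=
          Finset.sum_le_sum_of_subset_of_nonneg hCX fun _ _ _ => sq_nonneg _
      _ = (q - 1) * q ^ 2 * ((q + 1) * (2 * q)) := by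
          rw [h.sum_incidenceDegree_sub_sq]
          ring
  have hpos : 0 < (q - 1) * q ^ 2 * (q + 1) :=
    mul_pos (mul_pos (by lia) (by positivity)) (by lia)
  refine (four_mul_lt_of_sq_eq_two_mul hq hs).not_ge (le_of_mul_le_mul_left ?_ hpos)
  linear_combination 2 * hmoment - (q + 1) ^ 2 * hC

theorem add_one_sub_mul_add_one_add (hs : s ^ 2 = 2 * q) :
    (q + 1 - s) * (q + 1 + s) = q ^ 2 + 1 := by
  linear_combination -hs

theorem add_one_add_pos_of_sq_eq_two_mul (hq : 0 ≤ q) (hs : s ^ 2 = 2 * q) : 0 < q + 1 + s := by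
  nlinarith

theorem isCoprime_add_one_add (hs : s ^ 2 = 2 * q) :
    IsCoprime (q + 1 + s) ((q - 1) * q ^ 2) := by
  have hs_even : Even s := (Int.even_pow' two_ne_zero).1 (hs ▸ even_two_mul q)
  obtain ⟨k, rfl⟩ := hs_even.two_dvd
  obtain rfl : q = 2 * k ^ 2 := by linarith
  refine IsCoprime.of_mul_left_right (x := 2 * k ^ 2 + 1 - 2 * k) ?_
  rw [add_one_sub_mul_add_one_add hs]
  refine IsCoprime.mul_right ?_ (IsCoprime.pow_right ⟨1, -(2 * k ^ 2), by ring⟩)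
  exact ⟨k ^ 2, -(k ^ 2 * (2 * k ^ 2 + 1) + 1), by ring⟩

/-- The factor `q + 1 + s` of `q² + 1` is coprime to the cofactor `(q - 1) q²` in the size of the
class. -/
theorem exists_multiplicity_of_class_card {a n d : ℤ} (hq : 0 ≤ q) (hs : s ^ 2 = 2 * q)
    (ha : 2 * a = (q - 1) * q ^ 2 * (q + 1 - s)) (hsum : a * n = (q ^ 2 + 1) * d) :
    ∃ m, n = (q + 1 + s) * m ∧ 2 * d = m * ((q - 1) * q ^ 2) := by
  have hprod := add_one_sub_mul_add_one_add hs
  have hne : q + 1 - s ≠ 0 :=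
    (add_one_add_pos_of_sq_eq_two_mul (s := -s) hq (by rwa [neg_sq])).ne'
  have hnd : n * ((q - 1) * q ^ 2) = (q + 1 + s) * (2 * d) := by
    apply mul_left_cancel₀ hne
    linear_combination 2 * hsum - n * ha - 2 * d * hprod
  obtain ⟨m, rfl⟩ := (isCoprime_add_one_add hs).dvd_of_dvd_mul_right ⟨_, hnd⟩
  refine ⟨m, rfl, mul_left_cancel₀ (add_one_add_pos_of_sq_eq_two_mul hq hs).ne' ?_⟩
  rw [← hnd, mul_assoc]

/-- The class `A` meets each block in `m / 2` of its points for some `m ∈ {0, 1, 2}`; if `m` is `0`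
or `2`, then no point of `A`, respectively of `X \ A`, is on a block. -/
theorem HasOvoidParameters.incidenceDegree_eq_of_mem_class (h : HasOvoidParameters R X q)
    (hq : 8 ≤ q) (hs : s ^ 2 = 2 * q) (hAX : A ⊆ X)
    (hA : 2 * (A.card : ℤ) = (q - 1) * q ^ 2 * (q + 1 - s)) {n d : ℕ}
    (hn : ∀ x ∈ A, incidenceDegree R x = n) (hd : ∀ i, (A.filter (R i)).card = d) {x : α}
    (hx : x ∈ A) : (incidenceDegree R x : ℤ) = q + 1 + s := by
  classical
  have hcount : (A.card : ℤ) * n = (q ^ 2 + 1) * d := by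
    rw [← h.card_index, ← sum_incidenceDegree_of_forall_card (R := R) fun i => by rw [hd i],
      Finset.sum_congr rfl fun x hx => by rw [hn x hx], Finset.sum_const, nsmul_eq_mul]
  obtain ⟨m, hnm, hdm⟩ := exists_multiplicity_of_class_card (by lia) hs hA hcount
  have hfilter (i : ι) : A.filter (R i) ⊆ X.filter (R i) := Finset.filter_subset_filter _ hAX
  have hblock_pos : 0 < (q - 1) * q ^ 2 := mul_pos (by lia) (by positivity)
  have hm_nonneg : 0 ≤ m := by nlinarith
  have hm_le : m ≤ 2 := by
    obtain ⟨i⟩ : Nonempty ι := Fintype.card_pos_iff.1 (by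
      rw [← Int.natCast_pos, h.card_index]; positivity)
    have hle : (d : ℤ) ≤ (q - 1) * q ^ 2 := by
      rw [← hd i, ← h.card_block i]
      exact_mod_cast Finset.card_le_card (hfilter i)
    nlinarith
  have hm_ne_zero : m ≠ 0 := by
    rintro rfl
    refine h.not_forall_incidenceDegree_eq_zero hq hs hAX hA fun x hx => ?_
    rw [hn x hx]
    exact_mod_cast hnm.trans (mul_zero _)
  have hm_ne_two : m ≠ 2 := by
    rintro rfl
    refine h.not_forall_incidenceDegree_eq_zero (s := -s) hq (by rwa [neg_sq])
      (Finset.sdiff_subset (t := A)) ?_ fun x hx => ?_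
    · rw [Finset.cast_card_sdiff hAX, h.card_points]
      linear_combination -hA
    · refine Finset.card_eq_zero.2 (Finset.filter_eq_empty_iff.2 fun i _ hi => ?_)
      have hall : A.filter (R i) = X.filter (R i) := by
        refine Finset.eq_of_subset_of_card_le (hfilter i) (Nat.cast_le (α := ℤ).1 ?_)
        rw [h.card_block, hd]
        lia
      have hxA := hall.symm.subset (Finset.mem_filter.2 ⟨(Finset.mem_sdiff.1 hx).1, hi⟩)
      exact (Finset.mem_sdiff.1 hx).2 (Finset.mem_filter.1 hxA).1
  rw [hn x hx, hnm, show m = 1 by lia, mul_one]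

/-- The second moment about `q + 1 - s` is exhausted by the points of `A`. -/
theorem HasOvoidParameters.incidenceDegree_eq_of_notMem_class (h : HasOvoidParameters R X q)
    (hs : s ^ 2 = 2 * q) (hAX : A ⊆ X) (hA : 2 * (A.card : ℤ) = (q - 1) * q ^ 2 * (q + 1 - s))
    (hn : ∀ x ∈ A, (incidenceDegree R x : ℤ) = q + 1 + s) {x : α} (hx : x ∈ X) (hxA : x ∉ A) :
    (incidenceDegree R x : ℤ) = q + 1 - s := by
  refine eq_of_sum_sub_sq_eq (f := fun x => incidenceDegree R x) hAX ?_ hx hxA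
  rw [h.sum_incidenceDegree_sub_sq, Finset.sum_congr rfl (g := fun _ => 4 * s ^ 2)
    fun x hx => by rw [hn x hx]; ring, Finset.sum_const, nsmul_eq_mul]
  refine mul_left_cancel₀ (two_ne_zero (α := ℤ)) ?_
  linear_combination 4 * s ^ 2 * hA -
    2 * (q - 1) * q ^ 2 * (q + 1) * hs + 4 * (q - 1) * q ^ 2 * (q + 1 - s) * hs

end Incidence

section Ovoids

variable {F V ι : Type*} [Field F] [AddCommGroup V] [Module F V] {Q : QuadraticForm F V} {N : V}
  {τ : ι → V}

/-- The vectors `τ i` span the points of an ovoid of the parabolic quadric of `N^⊥`, which is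
encoded as a set of `q² + 1` points no two of which are on a line of the quadric. -/
structure IsOvoidFamily (Q : QuadraticForm F V) (N : V) (τ : ι → V) : Prop where
  singular (i : ι) : Q (τ i) = 0
  mem_perp (i : ι) : Q.polarBilin N (τ i) = 0
  polarBilin_ne_zero (i j : ι) : i ≠ j → Q.polarBilin (τ i) (τ j) ≠ 0
  card_eq : Nat.card ι = Nat.card F ^ 2 + 1

/-- The number of members of the family `τ` that are orthogonal to `x`. -/
abbrev perpDegree [DecidableEq F] [Fintype ι] (Q : QuadraticForm F V) (τ : ι → V) (x : V) : ℕ :=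
  incidenceDegree (fun i x => Q.polarBilin (τ i) x = 0) x

variable (F) in
/-- The vectors that span the points of the family `τ`, together with `0`. -/
def ovoidCone [DecidableEq F] [DecidableEq V] [Fintype F] [Fintype ι] (τ : ι → V) : Finset V :=
  insert 0 (Finset.univ.image fun z : ι × Fˣ => z.2 • τ z.1)

theorem exists_mem_span_of_mem_ovoidCone [DecidableEq F] [DecidableEq V] [Fintype F] [Fintype ι]
    {x : V} (hx : x ∈ ovoidCone F τ) (hx0 : x ≠ 0) : ∃ i, x ∈ Submodule.span F {τ i} := by
  obtain ⟨z, -, rfl⟩ := Finset.mem_image.1 (Finset.mem_of_mem_insert_of_ne hx hx0)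
  exact ⟨z.1, Submodule.mem_span_singleton.2 ⟨z.2, rfl⟩⟩

namespace IsOvoidFamily

theorem finite (hτ : IsOvoidFamily Q N τ) : Finite ι :=
  Nat.finite_of_card_ne_zero (by rw [hτ.card_eq]; exact Nat.succ_ne_zero _)

theorem nontrivial [Finite F] (hτ : IsOvoidFamily Q N τ) : Nontrivial ι := by
  have := hτ.finite
  rw [← Finite.one_lt_card_iff_nontrivial, hτ.card_eq]
  exact Nat.lt_add_of_pos_left (pow_pos Nat.card_pos 2)

theorem ne_zero [Finite F] (hτ : IsOvoidFamily Q N τ) (i : ι) : τ i ≠ 0 := by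
  have := hτ.nontrivial
  obtain ⟨j, hj⟩ := exists_ne i
  intro hi
  exact hτ.polarBilin_ne_zero j i hj (by rw [hi, map_zero])

theorem ovoidCone_subset [DecidableEq F] [DecidableEq V] [Fintype F] [Fintype ι]
    (hτ : IsOvoidFamily Q N τ) :
    (ovoidCone F τ : Set V) ⊆ {x | Q x = 0 ∧ Q.polarBilin N x = 0} := by
  intro x hx
  rcases Finset.mem_insert.1 hx with rfl | hx
  · exact ⟨Q.map_zero, map_zero _⟩
  · obtain ⟨⟨i, a⟩, -, rfl⟩ := Finset.mem_image.1 hx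
    constructor
    · rw [Units.smul_def, map_smul_sq, hτ.singular, mul_zero]
    · rw [Units.smul_def, map_smul, hτ.mem_perp, smul_zero]

variable [CharP F 2]

theorem polarBilin_eq_zero_iff (hτ : IsOvoidFamily Q N τ) {i j : ι} :
    Q.polarBilin (τ i) (τ j) = 0 ↔ i = j :=
  ⟨not_imp_not.1 (hτ.polarBilin_ne_zero i j), fun h => by rw [h, polarBilin_self]⟩

theorem polarBilin_units_smul_eq_zero_iff (hτ : IsOvoidFamily Q N τ) {i j : ι} (a : Fˣ) :
    Q.polarBilin (τ i) (a • τ j) = 0 ↔ i = j := by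
  rw [Units.smul_def, map_smul, smul_eq_zero_iff_right a.ne_zero, hτ.polarBilin_eq_zero_iff]

theorem perpDegree_units_smul [DecidableEq F] [Fintype ι] (hτ : IsOvoidFamily Q N τ) (i : ι)
    (a : Fˣ) : perpDegree Q τ (a • τ i) = 1 := by
  classical
  simp only [incidenceDegree, hτ.polarBilin_units_smul_eq_zero_iff]
  rw [Finset.filter_eq' Finset.univ i, if_pos (Finset.mem_univ i), Finset.card_singleton]

theorem injective_units_smul [Finite F] (hτ : IsOvoidFamily Q N τ) :
    Function.Injective fun z : ι × Fˣ => z.2 • τ z.1 := by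
  rintro ⟨i, a⟩ ⟨j, b⟩ (h : a • τ i = b • τ j)
  obtain rfl : j = i := by
    rw [← hτ.polarBilin_units_smul_eq_zero_iff a, h, hτ.polarBilin_units_smul_eq_zero_iff]
  rw [Units.ext (smul_left_injective F (hτ.ne_zero j) h)]

theorem sum_ovoidCone_perpDegree_sub_sq [DecidableEq F] [DecidableEq V] [Fintype F] [Fintype ι]
    (hτ : IsOvoidFamily Q N τ) :
    ∑ x ∈ ovoidCone F τ, ((perpDegree Q τ x : ℤ) - (Nat.card F + 1)) ^ 2 =
      (Nat.card F - 1) * (Nat.card F : ℤ) ^ 3 * (Nat.card F + 1) := by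
  have hcard : (Fintype.card ι : ℤ) = (Nat.card F : ℤ) ^ 2 + 1 := by
    rw [← Nat.card_eq_fintype_card]
    exact_mod_cast hτ.card_eq
  have hcard_units : (Fintype.card Fˣ : ℤ) = Nat.card F - 1 := by
    rw [← Nat.card_eq_fintype_card, Nat.card_units, Nat.cast_sub Nat.card_pos, Nat.cast_one]
  have hzero_notMem : (0 : V) ∉ Finset.univ.image fun z : ι × Fˣ => z.2 • τ z.1 := by
    rintro h
    obtain ⟨z, -, hz⟩ := Finset.mem_image.1 h
    exact smul_ne_zero z.2.ne_zero (hτ.ne_zero z.1) hz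
  have hdegree_zero : perpDegree Q τ 0 = Fintype.card ι := by
    simp only [incidenceDegree, map_zero, Finset.filter_true, Finset.card_univ]
  have hdegree (z : ι × Fˣ) :
      ((perpDegree Q τ (z.2 • τ z.1) : ℤ) - (Nat.card F + 1)) ^ 2 = (Nat.card F : ℤ) ^ 2 := by
    rw [hτ.perpDegree_units_smul]
    ring
  rw [ovoidCone, Finset.sum_insert hzero_notMem, Finset.sum_image hτ.injective_units_smul.injOn,
    Finset.sum_congr rfl fun z _ => hdegree z, Finset.sum_const, Finset.card_univ,
    Fintype.card_prod, nsmul_eq_mul, Nat.cast_mul, hdegree_zero, hcard, hcard_units]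
  ring

theorem sum_singular_perpDegree_sub_sq [DecidableEq F] [Finite F] [Fintype ι] (hV : finrank F V = 6)
    (hB : Q.polarBilin.Nondegenerate) (hN : Q N ≠ 0) (hτ : IsOvoidFamily Q N τ) {S : Finset V}
    (hS : (S : Set V) = {x | Q x = 0 ∧ Q.polarBilin N x = 0}) :
    ∑ x ∈ S, ((perpDegree Q τ x : ℤ) - (Nat.card F + 1)) ^ 2 =
      (Nat.card F - 1) * (Nat.card F : ℤ) ^ 3 * (Nat.card F + 1) := by
  have hmemS (x : V) : x ∈ S ↔ Q x = 0 ∧ Q.polarBilin N x = 0 := by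
    rw [← Finset.mem_coe, hS, Set.mem_ofPred_eq]
  have hcard : (Fintype.card ι : ℤ) = (Nat.card F : ℤ) ^ 2 + 1 := by
    rw [← Nat.card_eq_fintype_card]
    exact_mod_cast hτ.card_eq
  have hcardS : (S.card : ℤ) = (Nat.card F : ℤ) ^ 4 := by
    rw [← Set.ncard_coe_finset, hS, ncard_singular hV hB hN, Nat.cast_pow]
  have hblock (i : ι) :
      ((S.filter fun x => Q.polarBilin (τ i) x = 0).card : ℤ) = (Nat.card F : ℤ) ^ 3 := by
    rw [← Nat.cast_pow, ← ncard_singular_perp hV hB hN (hτ.ne_zero i) (hτ.singular i)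
      (hτ.mem_perp i), ← Set.ncard_coe_finset, Finset.coe_filter]
    simp only [hmemS, and_assoc]
  have hinter (i j : ι) (hij : i ≠ j) : ((S.filter fun x =>
      Q.polarBilin (τ i) x = 0 ∧ Q.polarBilin (τ j) x = 0).card : ℤ) = (Nat.card F : ℤ) ^ 2 := by
    rw [← Nat.cast_pow, ← ncard_singular_hyperbolic_perp hV hB hN (hτ.mem_perp i) (hτ.mem_perp j)
      (hτ.polarBilin_ne_zero i j hij), ← Set.ncard_coe_finset, Finset.coe_filter]
    simp only [hmemS, and_assoc, and_comm, and_left_comm]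
  rw [sum_incidenceDegree_sub_sq_of_forall_card hblock hinter, hcard, hcardS]
  ring

/-- The vectors of the ovoid account for the whole second moment about `q + 1`. -/
theorem perpDegree_eq_of_notMem_span [DecidableEq F] [Finite F] [Fintype ι] (hV : finrank F V = 6)
    (hB : Q.polarBilin.Nondegenerate) (hN : Q N ≠ 0) (hτ : IsOvoidFamily Q N τ) {P : V}
    (hP : P ≠ 0) (hQP : Q P = 0) (hNP : Q.polarBilin N P = 0)
    (hPτ : ∀ i, P ∉ Submodule.span F {τ i}) : perpDegree Q τ P = Nat.card F + 1 := by
  classical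
  have := Fintype.ofFinite F
  have hfin : Module.Finite F V := Module.finite_of_finrank_pos (by rw [hV]; norm_num)
  have hfinV : Finite V := Module.finite_of_finite F
  obtain ⟨S, hS⟩ := (Set.toFinite {x | Q x = 0 ∧ Q.polarBilin N x = 0}).exists_finset_coe
  have hdegree := eq_of_sum_sub_sq_eq (f := fun x => perpDegree Q τ x) (X := S)
    (A := ovoidCone F τ) (x := P) (Finset.coe_subset.1 (hS ▸ hτ.ovoidCone_subset))
    (hτ.sum_ovoidCone_perpDegree_sub_sq.trans
      (hτ.sum_singular_perpDegree_sub_sq hV hB hN hS).symm)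
    (Finset.mem_coe.1 (hS ▸ ⟨hQP, hNP⟩))
    fun hcone => (exists_mem_span_of_mem_ovoidCone hcone hP).elim hPτ
  exact_mod_cast hdegree

end IsOvoidFamily

theorem card_filter_polarBilin_add_smul_add [DecidableEq F] [Fintype F] (t x P : V) :
    (Finset.univ.filter fun a : F => Q.polarBilin t (x + a • P) = 0).card +
        (if Q.polarBilin t P = 0 then 1 else 0) =
      1 + Nat.card F * if Q.polarBilin t P = 0 ∧ Q.polarBilin t x = 0 then 1 else 0 := by
  by_cases hP : Q.polarBilin t P = 0
  · by_cases hx : Q.polarBilin t x = 0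
    · simp only [map_add, map_smul, hP, hx, smul_zero, add_zero, Finset.filter_true,
        Finset.card_univ, Nat.card_eq_fintype_card, and_self, if_true, mul_one, add_comm]
    · simp only [map_add, map_smul, hP, hx, smul_zero, add_zero, Finset.filter_false,
        Finset.card_empty, and_false, if_true, if_false, mul_zero]
  · have hcard : (Finset.univ.filter fun a : F => Q.polarBilin t (x + a • P) = 0).card = 1 :=
      (Fintype.existsUnique_iff_card_one _).1 (existsUnique_polarBilin_add_smul_eq_zero hP x)
    simp only [hcard, hP, false_and, if_false, mul_zero]

/-- Each `τ i` not orthogonal to `P` is orthogonal to exactly one of the vectors `x + a P`, and each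
other `τ i` to all or none of them. -/
theorem sum_perpDegree_add_smul_add [DecidableEq F] [Fintype F] [Fintype ι]
    (Q : QuadraticForm F V) (τ : ι → V) (x P : V) :
    ∑ a : F, perpDegree Q τ (x + a • P) + perpDegree Q τ P = Nat.card ι + Nat.card F *
      (Finset.univ.filter fun i => Q.polarBilin (τ i) P = 0 ∧ Q.polarBilin (τ i) x = 0).card := by
  have hcomm : ∑ a : F, perpDegree Q τ (x + a • P) =
      ∑ i, (Finset.univ.filter fun a : F => Q.polarBilin (τ i) (x + a • P) = 0).card :=
    sum_incidenceDegree (fun i a => Q.polarBilin (τ i) (x + a • P) = 0) Finset.univ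
  rw [hcomm, perpDegree, incidenceDegree, Finset.card_filter (fun i => Q.polarBilin (τ i) P = 0),
    ← Finset.sum_add_distrib,
    Finset.sum_congr rfl fun i _ => card_filter_polarBilin_add_smul_add (τ i) x P,
    Finset.sum_add_distrib, ← Finset.mul_sum, ← Finset.card_filter, Finset.sum_const,
    Finset.card_univ, smul_eq_mul, mul_one, Nat.card_eq_fintype_card (α := ι)]

namespace IsOvoidFamily

variable [CharP F 2] [Fintype F] [Fintype ι] {x P : V}

theorem sum_perpDegree_line_of_mem_span [DecidableEq F] (hτ : IsOvoidFamily Q N τ) (hP : P ≠ 0)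
    (hPx : Q.polarBilin P x = 0) {i : ι} (hi : P ∈ Submodule.span F {τ i}) :
    ∑ a : F, perpDegree Q τ (x + a • P) = Nat.card F ^ 2 + Nat.card F := by
  obtain ⟨c, rfl⟩ := Submodule.mem_span_singleton.1 hi
  obtain ⟨c, rfl⟩ : IsUnit c := isUnit_iff_ne_zero.2 (left_ne_zero_of_smul hP)
  have hfilter : (Finset.univ.filter fun j =>
      Q.polarBilin (τ j) (c • τ i) = 0 ∧ Q.polarBilin (τ j) x = 0) = {i} := by
    ext j
    rw [Finset.mem_filter_univ, hτ.polarBilin_units_smul_eq_zero_iff, Finset.mem_singleton]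
    refine ⟨And.left, fun hj => ⟨hj, hj ▸ ?_⟩⟩
    rwa [map_smul, LinearMap.smul_apply, smul_eq_zero_iff_right c.ne_zero] at hPx
  have hsum := sum_perpDegree_add_smul_add Q τ x (c • τ i)
  rw [hfilter, Finset.card_singleton, hτ.perpDegree_units_smul, hτ.card_eq] at hsum
  change ∑ a : F, perpDegree Q τ (x + a • c • τ i) = _
  lia

/-- No `τ i` is orthogonal to both `P` and `x`, since it would span with them a totally singular
plane. -/
theorem sum_perpDegree_line_of_notMem_span [DecidableEq F] (hV : finrank F V = 6)
    (hQ : IsElliptic Q) (hN : Q N ≠ 0) (hτ : IsOvoidFamily Q N τ) (hx : x ∈ affineQuadric Q N)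
    (hP : P ≠ 0) (hQP : Q P = 0) (hNP : Q.polarBilin N P = 0) (hPx : Q.polarBilin P x = 0)
    (hPτ : ∀ i, P ∉ Submodule.span F {τ i}) :
    ∑ a : F, perpDegree Q τ (x + a • P) + Nat.card F = Nat.card F ^ 2 := by
  have hfilter : (Finset.univ.filter fun i =>
      Q.polarBilin (τ i) P = 0 ∧ Q.polarBilin (τ i) x = 0) = ∅ := by
    refine Finset.filter_eq_empty_iff.2 fun i _ ⟨hiP, hix⟩ => ?_
    have hLI : LinearIndependent F ![τ i, P] :=
      (LinearIndependent.pair_iff' (hτ.ne_zero i)).2 fun a ha =>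
        hPτ i (Submodule.mem_span_singleton.2 ⟨a, ha⟩)
    exact hQ.polarBilin_ne_zero_of_mem_affineQuadric hLI (hτ.singular i) hQP (hτ.mem_perp i) hNP hiP
      hx hix hPx
  have hsum := sum_perpDegree_add_smul_add Q τ x P
  rw [hfilter, Finset.card_empty, hτ.perpDegree_eq_of_notMem_span hV hQ.1 hN hP hQP hNP hPτ,
    hτ.card_eq] at hsum
  lia

end IsOvoidFamily

end Ovoids

section Orbits

variable {F V : Type*} [Field F] [AddCommGroup V] [Module F V] {Q : QuadraticForm F V} {N : V}
  {T : Set (ℙ F V)} {G : Subgroup (V ≃ₗ[F] V)}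

theorem ncard_setOf_apply_eq_one_mk_mem {f : Dual F V} {S : Set (ℙ F V)}
    (hS : Disjoint S (pointsOf (LinearMap.ker f))) :
    {x | f x = 1 ∧ ∃ hx : x ≠ 0, Projectivization.mk F x hx ∈ S}.ncard = S.ncard := by
  refine Set.ncard_congr (fun x h => Projectivization.mk F x h.2.choose) ?_ ?_ ?_
  · exact fun x h => h.2.choose_spec
  · exact fun x y hx hy h => mk_inj_of_apply_eq_one hx.1 hy.1 h
  · intro p hp
    obtain ⟨x, hx, hfx, rfl⟩ := exists_mk_of_notMem_ker (Set.disjoint_left.1 hS hp)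
    exact ⟨x, ⟨hfx, hx, hp⟩, rfl⟩

theorem exists_smul_rep_eq (g : V ≃ₗ[F] V) (p : ℙ F V) :
    ∃ c : Fˣ, c • g p.rep = (g • p).rep := by
  conv => enter [1, c, 2, 1]; rw [← p.mk_rep]
  exact Projectivization.exists_smul_eq_mk_rep F (g p.rep) (by simpa using p.rep_nonzero)

theorem polarBilin_map_of_isometry {g : V ≃ₗ[F] V} (hg : ∀ x, Q (g x) = Q x) (x y : V) :
    Q.polarBilin (g x) (g y) = Q.polarBilin x y := by
  have hadd := map_add_polarBilin Q (g x) (g y)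
  rw [← map_add, hg, hg, hg, map_add_polarBilin] at hadd
  exact (add_left_cancel hadd).symm

/-- A group of isometries of `Q` that fix `N`, transitive on the point set `T`. -/
structure IsTransitiveIsometryGroup (G : Subgroup (V ≃ₗ[F] V)) (Q : QuadraticForm F V) (N : V)
    (T : Set (ℙ F V)) : Prop where
  map_form (g : V ≃ₗ[F] V) (hg : g ∈ G) (x : V) : Q (g x) = Q x
  map_nucleus (g : V ≃ₗ[F] V) (hg : g ∈ G) : g N = N
  smul_mem (g : V ≃ₗ[F] V) (hg : g ∈ G) (t : ℙ F V) (ht : t ∈ T) : g • t ∈ T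
  exists_smul_eq (t : ℙ F V) (ht : t ∈ T) (t' : ℙ F V) (ht' : t' ∈ T) : ∃ g ∈ G, g • t = t'

/-- A spanning vector of each point of the set `T`. -/
noncomputable abbrev repFamily (T : Set (ℙ F V)) (t : T) : V :=
  t.1.rep

theorem mem_iff_exists_rep_mem_span_repFamily {P : ℙ F V} :
    P ∈ T ↔ ∃ t : T, P.rep ∈ Submodule.span F {repFamily T t} := by
  refine ⟨fun hP => ⟨⟨P, hP⟩, Submodule.mem_span_singleton_self _⟩, ?_⟩
  rintro ⟨t, ht⟩
  have hPt : P = t := by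
    rw [← P.mk_rep, ← t.1.mk_rep]
    exact (Projectivization.mk_eq_mk_iff' F _ _ _ _).2 (Submodule.mem_span_singleton.1 ht)
  exact hPt ▸ t.2

namespace IsTransitiveIsometryGroup

theorem polarBilin_nucleus_map (hG : IsTransitiveIsometryGroup G Q N T) {g : V ≃ₗ[F] V}
    (hg : g ∈ G) (x : V) : Q.polarBilin N (g x) = Q.polarBilin N x := by
  conv_lhs => rw [← hG.map_nucleus g hg]
  exact polarBilin_map_of_isometry (hG.map_form g hg) N x

theorem orbit_subset_affineQuadric (hG : IsTransitiveIsometryGroup G Q N T) {x₀ : V}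
    (hx₀ : x₀ ∈ affineQuadric Q N) : MulAction.orbit G x₀ ⊆ affineQuadric Q N := by
  rintro _ ⟨⟨g, hg⟩, rfl⟩
  exact ⟨(hG.map_form g hg x₀).trans hx₀.1, (hG.polarBilin_nucleus_map hg x₀).trans hx₀.2⟩

theorem polarBilin_smul_rep_eq_zero_iff (hG : IsTransitiveIsometryGroup G Q N T) {g : V ≃ₗ[F] V}
    (hg : g ∈ G) (t : ℙ F V) (x : V) :
    Q.polarBilin (g • t).rep (g x) = 0 ↔ Q.polarBilin t.rep x = 0 := by
  obtain ⟨c, hc⟩ := exists_smul_rep_eq g t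
  rw [← hc, Units.smul_def, map_smul, LinearMap.smul_apply, smul_eq_zero_iff_right c.ne_zero,
    polarBilin_map_of_isometry (hG.map_form g hg)]

theorem perpDegree_eq_of_mem_orbit [DecidableEq F] [Fintype T]
    (hG : IsTransitiveIsometryGroup G Q N T) {x x₀ : V} (hx : x ∈ MulAction.orbit G x₀) :
    perpDegree Q (repFamily T) x = perpDegree Q (repFamily T) x₀ := by
  obtain ⟨⟨g, hg⟩, rfl⟩ := hx
  symm
  refine Finset.card_bij (fun t _ => ⟨g • t.1, hG.smul_mem g hg t t.2⟩) ?_ ?_ ?_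
  · intro t ht
    rw [Finset.mem_filter_univ] at ht ⊢
    exact (hG.polarBilin_smul_rep_eq_zero_iff hg t x₀).2 ht
  · intro t _ t' _ h
    exact Subtype.ext (MulAction.injective g (congrArg Subtype.val h))
  · intro t ht
    rw [Finset.mem_filter_univ] at ht
    refine ⟨⟨g⁻¹ • t.1, hG.smul_mem _ (G.inv_mem hg) t t.2⟩, ?_, Subtype.ext (smul_inv_smul g t.1)⟩
    rw [Finset.mem_filter_univ]
    refine (hG.polarBilin_smul_rep_eq_zero_iff hg (g⁻¹ • t.1) x₀).1 ?_
    rwa [smul_inv_smul]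

theorem card_orbit_filter_eq [DecidableEq F] (hG : IsTransitiveIsometryGroup G Q N T)
    {A : Finset V} {x₀ : V} (hA : (A : Set V) = MulAction.orbit G x₀) (t t' : T) :
    (A.filter fun x => Q.polarBilin (repFamily T t) x = 0).card =
      (A.filter fun x => Q.polarBilin (repFamily T t') x = 0).card := by
  obtain ⟨g, hg, hgt⟩ := hG.exists_smul_eq t t.2 t' t'.2
  have hA_map (x : V) : g x ∈ A ↔ x ∈ A := by
    rw [← Finset.mem_coe, ← Finset.mem_coe, hA, ← MulAction.orbit_eq_iff, ← MulAction.orbit_eq_iff]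
    exact Eq.congr_left (MulAction.orbit_smul (⟨g, hg⟩ : G) x)
  refine Finset.card_bij (fun x _ => g x) ?_ (fun x _ y _ h => g.injective h) ?_
  · intro x hx
    rw [Finset.mem_filter] at hx ⊢
    refine ⟨(hA_map x).2 hx.1, ?_⟩
    have := (hG.polarBilin_smul_rep_eq_zero_iff hg t x).2 hx.2
    rwa [hgt] at this
  · intro x hx
    rw [Finset.mem_filter] at hx
    refine ⟨g.symm x, Finset.mem_filter.2 ⟨(hA_map _).1 ?_, ?_⟩, g.apply_symm_apply x⟩
    · rw [g.apply_symm_apply]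
      exact hx.1
    · rw [← hG.polarBilin_smul_rep_eq_zero_iff hg, hgt, g.apply_symm_apply]
      exact hx.2

theorem mk_mem_orbit_iff (hG : IsTransitiveIsometryGroup G Q N T) {x x₀ : V} {hx : x ≠ 0}
    {hx₀ : x₀ ≠ 0} (hNx : Q.polarBilin N x = 1) (hNx₀ : Q.polarBilin N x₀ = 1) :
    Projectivization.mk F x hx ∈ MulAction.orbit G (Projectivization.mk F x₀ hx₀) ↔
      x ∈ MulAction.orbit G x₀ := by
  constructor
  · rintro ⟨⟨g, hg⟩, h⟩
    have hgx₀ : g x₀ ≠ 0 := g.map_ne_zero_iff.2 hx₀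
    exact ⟨⟨g, hg⟩, mk_inj_of_apply_eq_one (hx := hgx₀) (hy := hx)
      ((hG.polarBilin_nucleus_map hg x₀).trans hNx₀) hNx h⟩
  · rintro ⟨g, rfl⟩
    exact ⟨g, rfl⟩

end IsTransitiveIsometryGroup

theorem IsOvoidFamily.hasOvoidParameters [DecidableEq F] [Finite F] [CharP F 2] {ι : Type*}
    [Fintype ι] {τ : ι → V} (hτ : IsOvoidFamily Q N τ) (hV : finrank F V = 6) (hQ : IsElliptic Q)
    (hN : Q N ≠ 0) {X : Finset V} (hX : (X : Set V) = affineQuadric Q N) :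
    HasOvoidParameters (fun i x => Q.polarBilin (τ i) x = 0) X (Nat.card F) := by
  have := hτ.nontrivial
  have hcast : ((Nat.card F - 1 : ℕ) : ℤ) = Nat.card F - 1 := Nat.cast_pred Nat.card_pos
  have hfilter (p : V → Prop) [DecidablePred p] :
      (X.filter p).card = {x ∈ affineQuadric Q N | p x}.ncard := by
    rw [← hX, ← Set.ncard_coe_finset, Finset.coe_filter]
    rfl
  refine ⟨?_, ?_, fun i => ?_, fun i j hij => ?_⟩
  · rw [← Nat.card_eq_fintype_card, hτ.card_eq, Nat.cast_add, Nat.cast_pow, Nat.cast_one]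
  · obtain ⟨i, j, hij⟩ := exists_pair_ne ι
    rw [← Set.ncard_coe_finset, hX, hQ.ncard_affineQuadric hV hN (hτ.singular i) (hτ.mem_perp i)
      (hτ.mem_perp j) (hτ.polarBilin_ne_zero i j hij)]
    push_cast [hcast]
    ring
  · obtain ⟨j, hji⟩ := exists_ne i
    rw [hfilter, hQ.ncard_affineQuadric_perp hV hN (hτ.singular i) (hτ.mem_perp i)
      (hτ.mem_perp j) (hτ.polarBilin_ne_zero i j hji.symm)]
    push_cast [hcast]
    ring
  · rw [hfilter, hQ.ncard_affineQuadric_perp_perp hV hN (hτ.singular i) (hτ.mem_perp i)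
      (hτ.mem_perp j) (hτ.polarBilin_ne_zero i j hij)]
    push_cast [hcast]
    ring

section LinesOfQuadric

variable {l : Submodule F V} {P : ℙ F V}

theorem exists_smul_rep_eq_of_inter_baseLocus_eq (hlQ : pointsOf l ⊆ quadric Q)
    (hlP : pointsOf l ∩ baseLocus Q N = {P}) {y : V} (hy : y ∈ l) (hNy : Q.polarBilin N y = 0) :
    ∃ a : F, a • P.rep = y := by
  obtain rfl | hy0 := eq_or_ne y 0
  · exact ⟨0, zero_smul F _⟩
  have hyl : Projectivization.mk F y hy0 ∈ pointsOf l := (mk_mem_pointsOf hy0).2 hy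
  have hyP : Projectivization.mk F y hy0 ∈ pointsOf l ∩ baseLocus Q N :=
    ⟨hyl, hlQ hyl, (mk_mem_pointsOf hy0).2 hNy⟩
  rw [hlP, Set.mem_singleton_iff, ← P.mk_rep] at hyP
  exact (Projectivization.mk_eq_mk_iff' F _ _ _ _).1 hyP

theorem exists_mem_affineQuadric_of_inter_baseLocus_eq [Finite F] (hl : finrank F l = 2)
    (hlQ : pointsOf l ⊆ quadric Q) (hlP : pointsOf l ∩ baseLocus Q N = {P}) :
    ∃ x ∈ l, x ∈ affineQuadric Q N := by
  have hnot : ¬ pointsOf l ⊆ pointsOf (LinearMap.ker (Q.polarBilin N)) := by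
    intro hker
    have hcard := ncard_pointsOf_of_finrank_two hl
    rw [← Set.inter_eq_left.2 (Set.subset_inter hlQ hker), ← baseLocus, hlP,
      Set.ncard_singleton, eq_comm, Nat.add_eq_right] at hcard
    exact Nat.card_pos.ne' hcard
  obtain ⟨p, hpl, hp⟩ := Set.not_subset.1 hnot
  obtain ⟨x, hx, hNx, rfl⟩ := exists_mk_of_notMem_ker hp
  have hxl := (mk_mem_pointsOf hx).1 hpl
  exact ⟨x, hxl, pointsOf_subset_quadric_iff.1 hlQ x hxl, hNx⟩

end LinesOfQuadric

namespace IsTransitiveIsometryGroup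

variable {x₀ : V} {hx₀ : x₀ ≠ 0}

theorem disjoint_orbit_mk (hG : IsTransitiveIsometryGroup G Q N T)
    (hNx₀ : Q.polarBilin N x₀ = 1) :
    Disjoint (MulAction.orbit G (Projectivization.mk F x₀ hx₀))
      (pointsOf (LinearMap.ker (Q.polarBilin N))) := by
  rw [Set.disjoint_left]
  rintro _ ⟨⟨g, hg⟩, rfl⟩ hker
  have hker' : Q.polarBilin N (g x₀) = 0 := (mk_mem_pointsOf (g.map_ne_zero_iff.2 hx₀)).1 hker
  rw [hG.polarBilin_nucleus_map hg, hNx₀] at hker'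
  exact one_ne_zero hker'

theorem ncard_inter_orbit_mk (hG : IsTransitiveIsometryGroup G Q N T)
    (hNx₀ : Q.polarBilin N x₀ = 1) (U : Submodule F V) :
    (pointsOf U ∩ MulAction.orbit G (Projectivization.mk F x₀ hx₀)).ncard =
      {x | x ∈ U ∧ x ∈ MulAction.orbit G x₀}.ncard := by
  rw [← ncard_setOf_apply_eq_one_mk_mem
    ((hG.disjoint_orbit_mk hNx₀).mono_left Set.inter_subset_right)]
  congr 1
  ext x
  constructor
  · rintro ⟨hNx, hx, hxU, hx_orbit⟩
    exact ⟨(mk_mem_pointsOf hx).1 hxU, (hG.mk_mem_orbit_iff hNx hNx₀).1 hx_orbit⟩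
  · rintro ⟨hxU, ⟨g, hg⟩, rfl⟩
    have hNx : Q.polarBilin N (g x₀) = 1 := (hG.polarBilin_nucleus_map hg x₀).trans hNx₀
    have hx : g x₀ ≠ 0 := g.map_ne_zero_iff.2 hx₀
    exact ⟨hNx, hx, (mk_mem_pointsOf hx).2 hxU,
      (hG.mk_mem_orbit_iff hNx hNx₀).2 ⟨⟨g, hg⟩, rfl⟩⟩

/-- The points of `l` off `N^⊥` are spanned by the vectors `x + a P`. -/
theorem ncard_line_inter_orbit_mk (hG : IsTransitiveIsometryGroup G Q N T)
    (hNx₀ : Q.polarBilin N x₀ = 1) {l : Submodule F V} {P : ℙ F V} (hlQ : pointsOf l ⊆ quadric Q)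
    (hlP : pointsOf l ∩ baseLocus Q N = {P}) {x : V} (hxl : x ∈ l) (hNx : Q.polarBilin N x = 1) :
    (pointsOf l ∩ MulAction.orbit G (Projectivization.mk F x₀ hx₀)).ncard =
      {a : F | x + a • P.rep ∈ MulAction.orbit G x₀}.ncard := by
  have hPl : P.rep ∈ l := mem_pointsOf_iff_rep.1 (hlP.symm.subset rfl).1
  rw [hG.ncard_inter_orbit_mk hNx₀]
  symm
  refine Set.ncard_congr (fun a _ => x + a • P.rep) ?_ ?_ ?_
  · exact fun a ha => ⟨l.add_mem hxl (l.smul_mem a hPl), ha⟩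
  · exact fun a b _ _ h => smul_left_injective F P.rep_nonzero (add_left_cancel h)
  · rintro _ ⟨hyl, ⟨g, hg⟩, rfl⟩
    have hNy : Q.polarBilin N (g x₀) = 1 := (hG.polarBilin_nucleus_map hg x₀).trans hNx₀
    obtain ⟨a, ha⟩ := exists_smul_rep_eq_of_inter_baseLocus_eq hlQ hlP (l.sub_mem hyl hxl)
      (show Q.polarBilin N (g x₀ - x) = 0 by rw [map_sub, hNy, hNx, sub_self])
    have hxa : x + a • P.rep = g x₀ := by
      rw [ha]
      exact add_sub_cancel x (g x₀)
    exact ⟨a, ⟨⟨g, hg⟩, hxa.symm⟩, hxa⟩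

variable [CharP F 2] [Fintype T] {s : ℤ}

open Classical in
theorem perpDegree_eq [Finite F] (hG : IsTransitiveIsometryGroup G Q N T)
    (hT : IsOvoidFamily Q N (repFamily T)) (hV : finrank F V = 6) (hQ : IsElliptic Q)
    (hN : Q N ≠ 0) (hq : 8 ≤ Nat.card F) (hs : s ^ 2 = 2 * Nat.card F)
    (hx₀ : x₀ ∈ affineQuadric Q N) (hcard : 2 * ((MulAction.orbit G x₀).ncard : ℤ) =
      ((Nat.card F : ℤ) - 1) * Nat.card F ^ 2 * (Nat.card F + 1 - s))
    {x : V} (hx : x ∈ affineQuadric Q N) :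
    (perpDegree Q (repFamily T) x : ℤ) =
      Nat.card F + 1 - s + if x ∈ MulAction.orbit G x₀ then 2 * s else 0 := by
  have hfin : Module.Finite F V := Module.finite_of_finrank_pos (by rw [hV]; norm_num)
  have hfinV : Finite V := Module.finite_of_finite F
  obtain ⟨X, hX⟩ := (Set.toFinite (affineQuadric Q N)).exists_finset_coe
  obtain ⟨A, hA⟩ := (Set.toFinite (MulAction.orbit G x₀)).exists_finset_coe
  have hmem (y : V) : y ∈ A ↔ y ∈ MulAction.orbit G x₀ := by rw [← hA, Finset.mem_coe]
  have hAX : A ⊆ X := by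
    rw [← Finset.coe_subset, hA, hX]
    exact hG.orbit_subset_affineQuadric hx₀
  rw [← hA, Set.ncard_coe_finset] at hcard
  have hparam := hT.hasOvoidParameters hV hQ hN hX
  have ⟨t₀⟩ := hT.nontrivial.to_nonempty
  have hdeg (y : V) (hy : y ∈ A) : (perpDegree Q (repFamily T) y : ℤ) = Nat.card F + 1 + s :=
    hparam.incidenceDegree_eq_of_mem_class (by exact_mod_cast hq) hs hAX hcard
      (fun z hz => hG.perpDegree_eq_of_mem_orbit ((hmem z).1 hz))
      (fun t => hG.card_orbit_filter_eq hA t t₀) hy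
  rw [← hmem]
  split_ifs with hxA
  · rw [hdeg x hxA]
    ring
  · rw [add_zero]
    exact hparam.incidenceDegree_eq_of_notMem_class hs hAX hcard hdeg
      (by rwa [← Finset.mem_coe, hX]) hxA

open Classical in
theorem sum_perpDegree_line [Fintype F] (hG : IsTransitiveIsometryGroup G Q N T)
    (hT : IsOvoidFamily Q N (repFamily T)) (hV : finrank F V = 6) (hQ : IsElliptic Q)
    (hN : Q N ≠ 0) (hq : 8 ≤ Nat.card F) (hs : s ^ 2 = 2 * Nat.card F)
    (hx₀ : x₀ ∈ affineQuadric Q N) (hcard : 2 * ((MulAction.orbit G x₀).ncard : ℤ) =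
      ((Nat.card F : ℤ) - 1) * Nat.card F ^ 2 * (Nat.card F + 1 - s))
    {x P : V} (hx : x ∈ affineQuadric Q N) (hQP : Q P = 0) (hNP : Q.polarBilin N P = 0)
    (hPx : Q.polarBilin P x = 0) :
    ∑ a : F, (perpDegree Q (repFamily T) (x + a • P) : ℤ) = Nat.card F * (Nat.card F + 1 - s) +
      2 * s * {a : F | x + a • P ∈ MulAction.orbit G x₀}.ncard := by
  rw [Finset.sum_congr rfl fun a _ => hG.perpDegree_eq hT hV hQ hN hq hs hx₀ hcard
    (add_smul_mem_affineQuadric hx hQP hNP hPx a), Finset.sum_add_distrib, Finset.sum_const,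
    Finset.card_univ, nsmul_eq_mul, ← Finset.sum_filter, Finset.sum_const, nsmul_eq_mul,
    Nat.card_eq_fintype_card, ← Set.ncard_coe_finset, Finset.coe_filter_univ]
  ring

end IsTransitiveIsometryGroup

theorem IsOrbitOn.exists_mem_affineQuadric {A : Set (ℙ F V)}
    (hA : IsOrbitOn G (quadric Q \ baseLocus Q N) A) :
    ∃ (x₀ : V) (hx₀ : x₀ ≠ 0), x₀ ∈ affineQuadric Q N ∧
      A = MulAction.orbit G (Projectivization.mk F x₀ hx₀) := by
  obtain ⟨p, ⟨hpQ, hpN⟩, rfl⟩ := hA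
  obtain ⟨x₀, hx₀, hNx₀, rfl⟩ := exists_mk_of_notMem_ker fun hker => hpN ⟨hpQ, hker⟩
  exact ⟨x₀, hx₀, ⟨(mk_mem_quadric hx₀).1 hpQ, hNx₀⟩, rfl⟩

open Classical in
theorem IsTransitiveIsometryGroup.two_mul_ncard_line_inter_orbit [Finite F] [CharP F 2]
    (hG : IsTransitiveIsometryGroup G Q N T) (hT : IsOvoidFamily Q N (repFamily T))
    (hV : finrank F V = 6) (hQ : IsElliptic Q) (hN : Q N ≠ 0) (hq : 8 ≤ Nat.card F) {s : ℤ}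
    (hs : s ^ 2 = 2 * Nat.card F) {A : Set (ℙ F V)}
    (hA : IsOrbitOn G (quadric Q \ baseLocus Q N) A)
    (hcard : 2 * (A.ncard : ℤ) = ((Nat.card F : ℤ) - 1) * Nat.card F ^ 2 * (Nat.card F + 1 - s))
    {l : Submodule F V} (hl : IsPolarLine Q.polarBilin l) (hlQ : pointsOf l ⊆ quadric Q)
    {P : ℙ F V} (hlP : pointsOf l ∩ baseLocus Q N = {P}) :
    2 * ((pointsOf l ∩ A).ncard : ℤ) = if P ∈ T then (Nat.card F : ℤ) else Nat.card F - s := by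
  have := Fintype.ofFinite F
  have := hT.finite
  have := Fintype.ofFinite T
  obtain ⟨x₀, hx₀, hx₀_affine, rfl⟩ := hA.exists_mem_affineQuadric
  obtain ⟨x, hxl, hx⟩ := exists_mem_affineQuadric_of_inter_baseLocus_eq hl.1 hlQ hlP
  have hP := hlP.symm.subset (Set.mem_singleton P)
  have hQP : Q P.rep = 0 := mem_quadric_iff_rep.1 hP.2.1
  have hNP : Q.polarBilin N P.rep = 0 := mem_pointsOf_iff_rep.1 hP.2.2
  have hPx : Q.polarBilin P.rep x = 0 := hl.2 _ (mem_pointsOf_iff_rep.1 hP.1) x hxl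
  have hcard_affine : (MulAction.orbit G (Projectivization.mk F x₀ hx₀)).ncard =
      (MulAction.orbit G x₀).ncard := by
    have htop := hG.ncard_inter_orbit_mk (hx₀ := hx₀) hx₀_affine.2 ⊤
    rwa [Set.inter_eq_right.2 fun p _ => show p.submodule ≤ ⊤ from le_top,
      show {x | x ∈ (⊤ : Submodule F V) ∧ x ∈ MulAction.orbit G x₀} = MulAction.orbit G x₀ from
        Set.ext fun x => and_iff_right Submodule.mem_top] at htop
  rw [hcard_affine] at hcard
  have hsum := hG.sum_perpDegree_line hT hV hQ hN hq hs hx₀_affine hcard hx hQP hNP hPx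
  rw [hG.ncard_line_inter_orbit_mk hx₀_affine.2 hlQ hlP hxl hx.2]
  have hs0 : s ≠ 0 := by
    rintro rfl
    lia
  apply mul_left_cancel₀ hs0
  split_ifs with hPT
  · obtain ⟨t, ht⟩ := mem_iff_exists_rep_mem_span_repFamily.1 hPT
    have hline : ∑ a : F, (perpDegree Q (repFamily T) (x + a • P.rep) : ℤ) =
        (Nat.card F : ℤ) ^ 2 + Nat.card F := by
      exact_mod_cast hT.sum_perpDegree_line_of_mem_span P.rep_nonzero hPx ht
    linear_combination hline - hsum
  · have hline : (∑ a : F, (perpDegree Q (repFamily T) (x + a • P.rep) : ℤ)) + Nat.card F =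
        (Nat.card F : ℤ) ^ 2 := by
      exact_mod_cast hT.sum_perpDegree_line_of_notMem_span hV hQ hN hx P.rep_nonzero hQP hNP hPx
        fun t ht => hPT (mem_iff_exists_rep_mem_span_repFamily.2 ⟨t, ht⟩)
    linear_combination hline - hsum + hs

end Orbits

section TitsCoordinates

variable {F : Type*} [Field F]

/-- The coordinate `X₃ = xy + x^(σ+2) + y^σ` of the point of the Suzuki-Tits ovoid with parameters
`x, y`, where `σ` is given by its square root `θ`, that is `x^σ = (θ x)²`. -/
def titsZ (θ : F →+* F) (x y : F) : F := x * y + θ x ^ 2 * x ^ 2 + θ y ^ 2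

/-- The coordinate `X₄` of the point of the Suzuki-Tits ovoid with parameters `x, y`: the square
root `θ(x) x + θ(y)` of `x^(σ+2) + y^σ`. -/
def titsW (θ : F →+* F) (x y : F) : F := θ x * x + θ y

/-- Coordinate vectors of the points of the Suzuki-Tits ovoid, with `none` standing for the point at
infinity. The sixth coordinate, which vanishes, is the one outside the hyperplane `N^⊥`. -/
def titsVec (θ : F →+* F) : Option (F × F) → Fin 6 → F
  | none => ![0, 0, 0, 1, 0, 0]
  | some (x, y) => ![1, x, y, titsZ θ x y, titsW θ x y, 0]

/-- The normal form of a quadratic form that restricts to `X₀X₃ + X₁X₂ + X₄²` on the hyperplane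
`X₅ = 0`. -/
def stdForm (γ : F) (v : Fin 6 → F) : F :=
  v 0 * v 3 + v 1 * v 2 + v 4 ^ 2 + v 5 * v 4 + γ * v 5 ^ 2

/-- The translation of the Suzuki group taking the ovoid point with parameters `0, 0` to the one
with parameters `a, b`. -/
def titsTranslation (θ : F →+* F) (a b : F) : (Fin 6 → F) →ₗ[F] (Fin 6 → F) where
  toFun v := ![v 0, v 1 + a * v 0, v 2 + θ a ^ 2 * v 1 + b * v 0 + θ a * v 5,
    v 3 + (b + a * θ a ^ 2) * v 1 + a * v 2 + titsZ θ a b * v 0 + θ b * v 5,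
    v 4 + θ a * v 1 + titsW θ a b * v 0, v 5]
  map_add' v w := by
    ext i
    fin_cases i <;> simp <;> ring
  map_smul' c v := by
    ext i
    fin_cases i <;> simp <;> ring

/-- The diagonal elements of the Suzuki group. -/
def titsTorus (θ : F →+* F) (κ : F) : (Fin 6 → F) →ₗ[F] (Fin 6 → F) where
  toFun v := ![(κ * θ κ)⁻¹ * v 0, (θ κ)⁻¹ * v 1, θ κ * v 2, κ * θ κ * v 3, v 4, v 5]
  map_add' v w := by
    ext i
    fin_cases i <;> simp <;> ring
  map_smul' c v := by
    ext i
    fin_cases i <;> simp <;> ring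

/-- The involution of the Suzuki group that interchanges the ovoid point with parameters `0, 0` and
the point at infinity. -/
def titsInversion (F : Type*) [Field F] : (Fin 6 → F) →ₗ[F] (Fin 6 → F) where
  toFun v := ![v 3, v 2, v 1, v 0, v 4, v 5]
  map_add' v w := by
    ext i
    fin_cases i <;> simp
  map_smul' c v := by
    ext i
    fin_cases i <;> simp

variable {θ : F →+* F}

theorem stdForm_titsTranslation [CharP F 2] (γ a b : F) (v : Fin 6 → F) :
    stdForm γ (titsTranslation θ a b v) = stdForm γ v := by
  have : (2 : F) = 0 := CharTwo.two_eq_zero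
  simp only [stdForm, titsTranslation, titsZ, titsW, LinearMap.coe_mk, AddHom.coe_mk,
    Matrix.cons_val]
  grind

theorem stdForm_titsTorus (γ : F) {κ : F} (hκ : κ ≠ 0) (v : Fin 6 → F) :
    stdForm γ (titsTorus θ κ v) = stdForm γ v := by
  have hθκ : θ κ ≠ 0 := (map_ne_zero θ).2 hκ
  simp only [stdForm, titsTorus, LinearMap.coe_mk, AddHom.coe_mk, Matrix.cons_val]
  field_simp

theorem stdForm_titsInversion (γ : F) (v : Fin 6 → F) :
    stdForm γ (titsInversion F v) = stdForm γ v := by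
  simp only [stdForm, titsInversion, LinearMap.coe_mk, AddHom.coe_mk, Matrix.cons_val]
  ring

theorem stdForm_titsVec [CharP F 2] (γ : F) (i : Option (F × F)) :
    stdForm γ (titsVec θ i) = 0 := by
  have : (2 : F) = 0 := CharTwo.two_eq_zero
  rcases i with _ | ⟨x, y⟩ <;>
    simp only [stdForm, titsVec, titsZ, titsW, Matrix.cons_val] <;> grind

theorem titsVec_ne_zero (i : Option (F × F)) : titsVec θ i ≠ 0 := by
  rcases i with _ | ⟨x, y⟩
  · exact fun h => one_ne_zero (congrFun h 3)
  · exact fun h => one_ne_zero (congrFun h 0)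

theorem titsVec_apply_five (i : Option (F × F)) : titsVec θ i 5 = 0 := by
  rcases i with _ | ⟨x, y⟩ <;> rfl

theorem titsTranslation_titsVec_none (a b : F) :
    titsTranslation θ a b (titsVec θ none) = titsVec θ none := by
  ext i
  fin_cases i <;> simp [titsTranslation, titsVec]

theorem titsTranslation_titsVec_some [CharP F 2] (hθ : ∀ x, θ (θ x) ^ 2 = x) (a b x y : F) :
    titsTranslation θ a b (titsVec θ (some (x, y))) =
      titsVec θ (some (x + a, y + b + θ a ^ 2 * x)) := by
  have : (2 : F) = 0 := CharTwo.two_eq_zero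
  have ha := hθ a
  ext i
  fin_cases i <;> simp [titsTranslation, titsVec, titsZ, titsW] <;> grind

theorem titsTorus_titsVec_none (κ : F) :
    titsTorus θ κ (titsVec θ none) = (κ * θ κ) • titsVec θ none := by
  ext i
  fin_cases i <;> simp [titsTorus, titsVec]

theorem titsTorus_titsVec_some (hθ : ∀ x, θ (θ x) ^ 2 = x) {κ : F} (hκ : κ ≠ 0) (x y : F) :
    titsTorus θ κ (titsVec θ (some (x, y))) =
      (κ * θ κ)⁻¹ • titsVec θ (some (κ * x, κ * θ κ ^ 2 * y)) := by
  have hθκ : θ κ ≠ 0 := (map_ne_zero θ).2 hκ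
  ext i
  fin_cases i <;> simp [titsTorus, titsVec, titsZ, titsW, hθ κ] <;> field_simp

theorem titsZ_eq_mul_add_titsW_sq [CharP F 2] (x y : F) :
    titsZ θ x y = x * y + titsW θ x y ^ 2 := by
  have : (2 : F) = 0 := CharTwo.two_eq_zero
  simp only [titsZ, titsW]
  grind

theorem titsW_mul_map_titsZ [CharP F 2] (hθ : ∀ x, θ (θ x) ^ 2 = x) (x y : F) :
    titsW θ x y * θ (titsZ θ x y) = θ y * y + θ x * titsZ θ x y := by
  have : (2 : F) = 0 := CharTwo.two_eq_zero
  simp only [titsZ, titsW, map_add, map_mul, map_pow, hθ]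
  grind

theorem titsZ_eq_zero_iff [CharP F 2] (hθ : ∀ x, θ (θ x) ^ 2 = x) {x y : F} :
    titsZ θ x y = 0 ↔ (x, y) = 0 := by
  rw [Prod.mk_eq_zero]
  refine ⟨fun h => ?_, fun ⟨hx, hy⟩ => by simp [titsZ, hx, hy]⟩
  have hy := titsW_mul_map_titsZ hθ x y
  rw [h, map_zero, mul_zero, mul_zero, add_zero, eq_comm, mul_eq_zero, map_eq_zero, or_self] at hy
  subst hy
  simpa [titsZ] using h

theorem titsZ_add_titsZ [CharP F 2] (hθ : ∀ x, θ (θ x) ^ 2 = x) (x y x' y' : F) :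
    titsZ θ x y + titsZ θ x' y' + x * y' + x' * y =
      titsZ θ (x + x') (y + y' + θ x ^ 2 * (x + x')) := by
  have : (2 : F) = 0 := CharTwo.two_eq_zero
  have hx := hθ x
  simp only [titsZ, map_add, map_mul, map_pow, hx]
  grind

theorem titsInversion_titsVec_none :
    titsInversion F (titsVec θ none) = titsVec θ (some (0, 0)) := by
  ext i
  fin_cases i <;> simp [titsInversion, titsVec, titsZ, titsW]

theorem titsInversion_titsVec_zero :
    titsInversion F (titsVec θ (some (0, 0))) = titsVec θ none := by
  ext i
  fin_cases i <;> simp [titsInversion, titsVec, titsZ, titsW]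

theorem titsInversion_titsVec_some [CharP F 2] (hθ : ∀ x, θ (θ x) ^ 2 = x) {x y : F}
    (hxy : (x, y) ≠ 0) :
    titsInversion F (titsVec θ (some (x, y))) =
      titsZ θ x y • titsVec θ (some (y / titsZ θ x y, x / titsZ θ x y)) := by
  have hz : titsZ θ x y ≠ 0 := mt (titsZ_eq_zero_iff hθ).1 hxy
  have hθz : θ (titsZ θ x y) ≠ 0 := (map_ne_zero θ).2 hz
  have hW : titsZ θ x y * titsW θ (y / titsZ θ x y) (x / titsZ θ x y) = titsW θ x y := by
    rw [titsW, map_div₀, map_div₀, eq_div_of_mul_eq hθz (titsW_mul_map_titsZ hθ x y)]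
    field_simp
  have hZ : titsZ θ x y * titsZ θ (y / titsZ θ x y) (x / titsZ θ x y) = 1 := by
    rw [titsZ_eq_mul_add_titsW_sq (y / _), eq_div_of_mul_eq hz ((mul_comm _ _).trans hW)]
    field_simp
    rw [mul_comm y x, ← titsZ_eq_mul_add_titsW_sq]
  ext i
  fin_cases i <;> simp [titsInversion, titsVec, hZ, hW, mul_div_cancel₀, hz]

end TitsCoordinates

section SuzukiGroup

variable {F V : Type*} [Field F] [AddCommGroup V] [Module F V] {Q : QuadraticForm F V} {N : V}

theorem polarBilin_of_map_eq_stdForm [CharP F 2] {γ : F} {Φ : (Fin 6 → F) →ₗ[F] V}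
    (hΦ : ∀ v, Q (Φ v) = stdForm γ v) (v w : Fin 6 → F) :
    Q.polarBilin (Φ v) (Φ w) = v 0 * w 3 + v 3 * w 0 + v 1 * w 2 + v 2 * w 1 + v 5 * w 4 +
      v 4 * w 5 := by
  have hadd := map_add_polarBilin Q (Φ v) (Φ w)
  rw [← map_add, hΦ, hΦ, hΦ] at hadd
  simp only [stdForm, Pi.add_apply] at hadd
  linear_combination -hadd + (v 4 * w 4 + γ * v 5 * w 5) * CharTwo.two_eq_zero (R := F)

theorem eq_single_of_polarBilin_eq_zero [CharP F 2] {γ : F} {Φ : (Fin 6 → F) →ₗ[F] V}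
    (hΦ : ∀ v, Q (Φ v) = stdForm γ v) {v : Fin 6 → F}
    (hv : ∀ i : Fin 5, Q.polarBilin (Φ v) (Φ (Pi.single i.castSucc 1)) = 0) :
    v = Pi.single 4 (v 4) := by
  simp only [polarBilin_of_map_eq_stdForm hΦ] at hv
  ext i
  fin_cases i
  exacts [by simpa using hv 3, by simpa using hv 2, by simpa using hv 1, by simpa using hv 0,
    by simp, by simpa using hv 4]

theorem injective_of_map_eq_stdForm [CharP F 2] {γ : F} {Φ : (Fin 6 → F) →ₗ[F] V}
    (hΦ : ∀ v, Q (Φ v) = stdForm γ v) : Function.Injective Φ := by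
  refine (injective_iff_map_eq_zero Φ).2 fun v hv => ?_
  have hv4 : v = Pi.single 4 (v 4) := eq_single_of_polarBilin_eq_zero hΦ fun i => by
    rw [hv, map_zero, LinearMap.zero_apply]
  have hpol := polarBilin_of_map_eq_stdForm hΦ v (Pi.single 5 1)
  rw [hv, map_zero, LinearMap.zero_apply] at hpol
  rw [hv4, show v 4 = 0 by simpa using hpol.symm, Pi.single_zero]

section Coordinates

variable [CharP F 2] {e : Fin 5 → V}
  (he : ∀ x : Fin 5 → F, Q (∑ i, x i • e i) = x 0 * x 3 + x 1 * x 2 + x 4 ^ 2)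

include he

theorem polarBilin_sum_smul_sum_smul (x y : Fin 5 → F) :
    Q.polarBilin (∑ i, x i • e i) (∑ i, y i • e i) =
      x 0 * y 3 + x 3 * y 0 + x 1 * y 2 + x 2 * y 1 := by
  have hadd := map_add_polarBilin Q (∑ i, x i • e i) (∑ i, y i • e i)
  rw [← Finset.sum_add_distrib,
    Finset.sum_congr rfl fun i _ => (add_smul (x i) (y i) (e i)).symm, he, he,
    he] at hadd
  linear_combination (x 4 * y 4) * CharTwo.two_eq_zero (R := F) - hadd

theorem exists_polarBilin_sum_smul_eq (hB : Q.polarBilin.Nondegenerate) :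
    ∃ u, ∀ x : Fin 5 → F, Q.polarBilin (∑ i, x i • e i) u = x 4 := by
  have hsingle (i : Fin 5) : e i = ∑ j, (Pi.single i 1 : Fin 5 → F) j • e j := by
    simp [Pi.single_apply]
  have he4 : Q (e 4) = 1 := by
    rw [hsingle, he]
    simp
  obtain ⟨u₀, hu₀⟩ : ∃ u, Q.polarBilin (e 4) u = 1 := by
    by_contra! h
    refine ne_zero_of_map_ne_zero (he4.trans_ne one_ne_zero) (hB.1 (e 4) fun y => ?_)
    by_contra hy
    exact h ((Q.polarBilin (e 4) y)⁻¹ • y) (by rw [map_smul, smul_eq_mul, inv_mul_cancel₀ hy])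
  let c : Fin 5 → F := ![Q.polarBilin (e 3) u₀, Q.polarBilin (e 2) u₀, Q.polarBilin (e 1) u₀,
    Q.polarBilin (e 0) u₀, 0]
  refine ⟨u₀ - ∑ i, c i • e i, fun x => ?_⟩
  rw [map_sub, polarBilin_sum_smul_sum_smul he, map_sum, LinearMap.sum_apply]
  simp only [map_smul, LinearMap.smul_apply, Fin.sum_univ_five, hu₀, smul_eq_mul, c,
    Matrix.cons_val]
  ring

theorem exists_linearEquiv_map_eq_stdForm (hV : finrank F V = 6)
    (hB : Q.polarBilin.Nondegenerate) :
    ∃ (γ : F) (Ψ : (Fin 6 → F) ≃ₗ[F] V), (∀ v, Q (Ψ v) = stdForm γ v) ∧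
      ∀ v, v 5 = 0 → Ψ v = ∑ i : Fin 5, v i.castSucc • e i := by
  have hfin : Module.Finite F V := Module.finite_of_finrank_pos (by rw [hV]; norm_num)
  obtain ⟨u, hu⟩ := exists_polarBilin_sum_smul_eq he hB
  let Φ : (Fin 6 → F) →ₗ[F] V := Fintype.linearCombination F (Fin.snoc e u : Fin 6 → V)
  have hΦ (v : Fin 6 → F) : Φ v = ∑ i : Fin 5, v i.castSucc • e i + v 5 • u := by
    simp only [Φ, Fintype.linearCombination_apply, Fin.sum_univ_castSucc (n := 5),
      Fin.snoc_castSucc, Fin.snoc_last]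
    rfl
  have hQΦ (v : Fin 6 → F) : Q (Φ v) = stdForm (Q u) v := by
    rw [hΦ, map_add_polarBilin, he fun i => v i.castSucc, map_smul_sq, map_smul,
      hu fun i => v i.castSucc, stdForm, smul_eq_mul]
    change v 0 * v 3 + v 1 * v 2 + v 4 ^ 2 + v 5 ^ 2 * Q u + v 5 * v 4 = _
    ring
  refine ⟨Q u, LinearMap.linearEquivOfInjective Φ (injective_of_map_eq_stdForm hQΦ)
    (by rw [hV, finrank_fin_fun]), hQΦ, fun v hv => (hΦ v).trans ?_⟩
  rw [hv, zero_smul, add_zero]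

end Coordinates

/-- The point of the Suzuki-Tits ovoid with parameter `i` in the coordinate system `Ψ` of `V`. -/
def titsPoint (Ψ : (Fin 6 → F) ≃ₗ[F] V) (θ : F →+* F) (i : Option (F × F)) : ℙ F V :=
  Projectivization.mk F (Ψ (titsVec θ i)) (Ψ.map_ne_zero_iff.2 (titsVec_ne_zero i))

/-- A coordinate system `Ψ` of `V` adapted to a Suzuki-Tits ovoid `T`: the form `Q` is
`stdForm γ`, the nucleus `N` is a multiple of the fifth basis vector, and `T` is the standard
Suzuki-Tits ovoid for the square root `θ` of `σ`. -/
structure IsTitsCoordinates (Q : QuadraticForm F V) (N : V) (T : Set (ℙ F V)) (θ : F →+* F)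
    (γ : F) (Ψ : (Fin 6 → F) ≃ₗ[F] V) : Prop where
  map_map_sq (x : F) : θ (θ x) ^ 2 = x
  map_form (v : Fin 6 → F) : Q (Ψ v) = stdForm γ v
  exists_nucleus_eq : ∃ n, N = Ψ (Pi.single 4 n)
  eq_range : T = Set.range (titsPoint Ψ θ)

theorem titsCoords_eq_range [CharP F 2] (h : ℕ) :
    titsCoords F h = Set.range fun (i : Option (F × F)) (j : Fin 5) =>
      titsVec (iterateFrobenius F 2 h) i j.castSucc := by
  have hθ (x : F) : iterateFrobenius F 2 h x = x ^ 2 ^ h := iterateFrobenius_def ..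
  have hsome (x y : F) :
      (fun j : Fin 5 => titsVec (iterateFrobenius F 2 h) (some (x, y)) j.castSucc) =
        ![1, x, y, x * y + x ^ (2 ^ (h + 1) + 2) + y ^ 2 ^ (h + 1),
          x ^ (2 ^ h + 1) + y ^ 2 ^ h] := by
    ext j
    fin_cases j <;> simp [titsVec, titsZ, titsW, hθ] <;> ring
  have hnone : (fun j : Fin 5 => titsVec (iterateFrobenius F 2 h) none j.castSucc) =
      ![0, 0, 0, 1, 0] := by
    ext j
    fin_cases j <;> simp [titsVec]
  ext v
  simp only [titsCoords, Set.singleton_union, Set.mem_insert_iff, Set.mem_ofPred_eq, Set.mem_range,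
    Option.exists, Prod.exists, hsome, hnone, eq_comm]

theorem IsSuzukiTitsOvoid.exists_isTitsCoordinates [Finite F] [CharP F 2] (hV : finrank F V = 6)
    (hB : Q.polarBilin.Nondegenerate) {T : Set (ℙ F V)} {h : ℕ}
    (hq : Nat.card F = 2 ^ (2 * h + 1)) (hT : IsSuzukiTitsOvoid h Q N T) :
    ∃ θ γ Ψ, IsTitsCoordinates Q N T θ γ Ψ := by
  obtain ⟨e, hNe, he, rfl⟩ := hT
  obtain ⟨γ, Ψ, hΨ, hΨe⟩ := exists_linearEquiv_map_eq_stdForm he hV hB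
  refine ⟨iterateFrobenius F 2 h, γ, Ψ, fun x => ?_, hΨ, ?_, ?_⟩
  · have := Fintype.ofFinite F
    have hcard : 2 ^ h * (2 ^ h * 2) = Fintype.card F := by
      rw [← Nat.card_eq_fintype_card, hq]
      ring
    rw [iterateFrobenius_def, iterateFrobenius_def, ← pow_mul, ← pow_mul, hcard,
      FiniteField.pow_card]
  · obtain ⟨v, rfl⟩ := Ψ.surjective N
    refine ⟨v 4, congrArg Ψ (eq_single_of_polarBilin_eq_zero (Φ := Ψ.toLinearMap) hΨ fun i => ?_)⟩
    have hei : Ψ (Pi.single i.castSucc 1) = e i := by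
      rw [hΨe _ (Pi.single_eq_of_ne (Fin.castSucc_lt_last i).ne' 1)]
      simp [Pi.single_apply]
    exact hei ▸ hNe i
  · ext p
    rw [titsCoords_eq_range, Set.mem_ofPred_eq, Set.exists_range_iff, Set.mem_range]
    refine exists_congr fun i => ?_
    rw [← hΨe _ (titsVec_apply_five i), eq_comm, ← Projectivization.submodule_injective.eq_iff,
      titsPoint, Projectivization.submodule_mk, eq_comm]

namespace IsTitsCoordinates

variable {T : Set (ℙ F V)} {θ : F →+* F} {γ : F} {Ψ : (Fin 6 → F) ≃ₗ[F] V}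

theorem polarBilin_apply_apply [CharP F 2] (hΨ : IsTitsCoordinates Q N T θ γ Ψ)
    (v w : Fin 6 → F) :
    Q.polarBilin (Ψ v) (Ψ w) = v 0 * w 3 + v 3 * w 0 + v 1 * w 2 + v 2 * w 1 + v 5 * w 4 +
      v 4 * w 5 :=
  polarBilin_of_map_eq_stdForm (Φ := Ψ.toLinearMap) hΨ.map_form v w

theorem polarBilin_titsVec_ne_zero [CharP F 2] (hΨ : IsTitsCoordinates Q N T θ γ Ψ)
    {i j : Option (F × F)} (hij : i ≠ j) :
    Q.polarBilin (Ψ (titsVec θ i)) (Ψ (titsVec θ j)) ≠ 0 := by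
  rw [hΨ.polarBilin_apply_apply]
  rcases i with _ | ⟨x, y⟩ <;> rcases j with _ | ⟨x', y'⟩
  · exact absurd rfl hij
  · simp [titsVec]
  · simp [titsVec]
  · intro h
    have hZ : titsZ θ x y + titsZ θ x' y' + x * y' + x' * y = 0 := by
      rw [← h]
      simp only [titsVec, Matrix.cons_val]
      ring
    rw [titsZ_add_titsZ hΨ.map_map_sq, titsZ_eq_zero_iff hΨ.map_map_sq, Prod.mk_eq_zero] at hZ
    obtain ⟨hx, hy⟩ := hZ
    rw [hx, mul_zero, add_zero] at hy
    rw [CharTwo.add_eq_zero] at hx hy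
    exact hij (by rw [hx, hy])

theorem injective_titsPoint [CharP F 2] (hΨ : IsTitsCoordinates Q N T θ γ Ψ) :
    Function.Injective (titsPoint Ψ θ) := by
  intro i j hij
  by_contra hne
  refine hΨ.polarBilin_titsVec_ne_zero hne ?_
  obtain ⟨a, ha⟩ := (Projectivization.mk_eq_mk_iff' F _ _ _ _).1 hij
  rw [← ha, map_smul, LinearMap.smul_apply, polarBilin_self, smul_zero]

theorem exists_rep_titsPoint_eq (Ψ : (Fin 6 → F) ≃ₗ[F] V) (i : Option (F × F)) :
    ∃ c : Fˣ, (titsPoint Ψ θ i).rep = c • Ψ (titsVec θ i) := by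
  obtain ⟨c, hc⟩ := Projectivization.exists_smul_eq_mk_rep F (Ψ (titsVec θ i))
    (Ψ.map_ne_zero_iff.2 (titsVec_ne_zero i))
  exact ⟨c, hc.symm⟩

theorem isOvoidFamily [Finite F] [CharP F 2] (hΨ : IsTitsCoordinates Q N T θ γ Ψ) :
    IsOvoidFamily Q N (repFamily T) := by
  obtain ⟨n, rfl⟩ := hΨ.exists_nucleus_eq
  have hinj := hΨ.injective_titsPoint
  have hΨ' := hΨ
  obtain rfl := hΨ.eq_range
  refine ⟨?_, ?_, ?_, ?_⟩
  · rintro ⟨_, i, rfl⟩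
    obtain ⟨c, hc⟩ := exists_rep_titsPoint_eq Ψ i
    rw [repFamily, hc, Units.smul_def, map_smul_sq, hΨ.map_form, stdForm_titsVec, mul_zero]
  · rintro ⟨_, i, rfl⟩
    obtain ⟨c, hc⟩ := exists_rep_titsPoint_eq Ψ i
    rw [repFamily, hc, Units.smul_def, map_smul, hΨ.polarBilin_apply_apply, titsVec_apply_five]
    simp
  · rintro ⟨_, i, rfl⟩ ⟨_, j, rfl⟩ hij
    obtain ⟨c, hc⟩ := exists_rep_titsPoint_eq Ψ i
    obtain ⟨d, hd⟩ := exists_rep_titsPoint_eq Ψ j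
    rw [repFamily, repFamily, hc, hd, Units.smul_def, Units.smul_def, map_smul, map_smul,
      LinearMap.smul_apply]
    refine smul_ne_zero d.ne_zero (smul_ne_zero c.ne_zero (hΨ.polarBilin_titsVec_ne_zero ?_))
    rintro rfl
    exact hij rfl
  · rw [Nat.card_range_of_injective hinj, Finite.card_option, Nat.card_prod, sq]

theorem exists_mem_ovoidStabilizer [Finite F] [CharP F 2] (hΨ : IsTitsCoordinates Q N T θ γ Ψ)
    {φ : (Fin 6 → F) →ₗ[F] (Fin 6 → F)} (hφ : ∀ v, stdForm γ (φ v) = stdForm γ v)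
    (hφN : ∀ n, φ (Pi.single 4 n) = Pi.single 4 n)
    (hφT : ∀ i, ∃ (c : F) (j : Option (F × F)), φ (titsVec θ i) = c • titsVec θ j) :
    ∃ g ∈ ovoidStabilizer Q N T, ∀ i (c : F) j, φ (titsVec θ i) = c • titsVec θ j →
      g • titsPoint Ψ θ i = titsPoint Ψ θ j := by
  obtain ⟨n, rfl⟩ := hΨ.exists_nucleus_eq
  obtain rfl := hΨ.eq_range
  have hform (v : Fin 6 → F) : Q ((Ψ.toLinearMap ∘ₗ φ) v) = stdForm γ v :=
    (hΨ.map_form (φ v)).trans (hφ v)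
  have hinj := injective_of_map_eq_stdForm hform
  have : Module.Finite F V := .equiv Ψ
  let g : V ≃ₗ[F] V := Ψ.symm ≪≫ₗ LinearMap.linearEquivOfInjective _ hinj Ψ.finrank_eq
  have hg (v : Fin 6 → F) : g (Ψ v) = Ψ (φ v) := by simp [g]
  have hpoint (i : Option (F × F)) (c : F) (j : Option (F × F))
      (hij : φ (titsVec θ i) = c • titsVec θ j) : g • titsPoint Ψ θ i = titsPoint Ψ θ j :=
    (Projectivization.mk_eq_mk_iff' F _ _ _ _).2
      ⟨c, by rw [← map_smul, ← hij]; exact (hg _).symm⟩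
  refine ⟨g, ⟨⟨?_, ?_⟩, ?_⟩, hpoint⟩
  · intro x
    obtain ⟨v, rfl⟩ := Ψ.surjective x
    rw [hg, hΨ.map_form, hΨ.map_form, hφ]
  · exact (hg _).trans (congrArg Ψ (hφN n))
  · refine (MulAction.mem_stabilizer_set_iff_smul_set_subset (Set.finite_range _)).2 ?_
    rintro _ ⟨_, ⟨i, rfl⟩, rfl⟩
    obtain ⟨c, j, hij⟩ := hφT i
    exact ⟨j, (hpoint i c j hij).symm⟩

theorem exists_translation [Finite F] [CharP F 2] (hΨ : IsTitsCoordinates Q N T θ γ Ψ) (a b : F) :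
    ∃ g ∈ ovoidStabilizer Q N T, ∀ x y, g • titsPoint Ψ θ (some (x, y)) =
      titsPoint Ψ θ (some (x + a, y + b + θ a ^ 2 * x)) := by
  have hnone := titsTranslation_titsVec_none (θ := θ) a b
  have hsome := titsTranslation_titsVec_some hΨ.map_map_sq a b
  obtain ⟨g, hg, hgpoint⟩ := hΨ.exists_mem_ovoidStabilizer (stdForm_titsTranslation γ a b)
    (fun n => by ext i; fin_cases i <;> simp [titsTranslation]) fun
      | none => ⟨1, none, hnone.trans (one_smul F _).symm⟩
      | some (x, y) => ⟨1, _, (hsome x y).trans (one_smul F _).symm⟩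
  exact ⟨g, hg, fun x y => hgpoint _ 1 _ ((hsome x y).trans (one_smul F _).symm)⟩

theorem exists_torus [Finite F] [CharP F 2] (hΨ : IsTitsCoordinates Q N T θ γ Ψ) {κ : F}
    (hκ : κ ≠ 0) :
    ∃ g ∈ ovoidStabilizer Q N T, ∀ x y, g • titsPoint Ψ θ (some (x, y)) =
      titsPoint Ψ θ (some (κ * x, κ * θ κ ^ 2 * y)) := by
  have hsome := titsTorus_titsVec_some hΨ.map_map_sq hκ
  obtain ⟨g, hg, hgpoint⟩ := hΨ.exists_mem_ovoidStabilizer (stdForm_titsTorus γ hκ)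
    (fun n => by ext i; fin_cases i <;> simp [titsTorus]) fun
      | none => ⟨_, none, titsTorus_titsVec_none κ⟩
      | some (x, y) => ⟨_, _, hsome x y⟩
  exact ⟨g, hg, fun x y => hgpoint _ _ _ (hsome x y)⟩

theorem exists_inversion [Finite F] [CharP F 2] (hΨ : IsTitsCoordinates Q N T θ γ Ψ) :
    ∃ g ∈ ovoidStabilizer Q N T,
      g • titsPoint Ψ θ (some (0, 0)) = titsPoint Ψ θ none ∧
      ∀ x y, (x, y) ≠ 0 → ∃ x' y', g • titsPoint Ψ θ (some (x, y)) =
        titsPoint Ψ θ (some (x', y')) := by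
  have hzero := (titsInversion_titsVec_zero (θ := θ)).trans (one_smul F _).symm
  obtain ⟨g, hg, hgpoint⟩ := hΨ.exists_mem_ovoidStabilizer (stdForm_titsInversion γ)
    (fun n => by ext i; fin_cases i <;> simp [titsInversion]) fun
      | none => ⟨1, _, titsInversion_titsVec_none.trans (one_smul F _).symm⟩
      | some (x, y) => (eq_or_ne (x, y) 0).elim
          (fun hxy => ⟨1, none, by rw [hxy]; exact hzero⟩)
          fun hxy => ⟨_, _, titsInversion_titsVec_some hΨ.map_map_sq hxy⟩
  exact ⟨g, hg, hgpoint _ 1 _ hzero, fun x y hxy =>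
    ⟨_, _, hgpoint _ _ _ (titsInversion_titsVec_some hΨ.map_map_sq hxy)⟩⟩

theorem exists_torus_parameter [Finite F] (hθ : ∀ x, θ (θ x) ^ 2 = x) (hq : 2 < Nat.card F) :
    ∃ κ : F, κ ≠ 0 ∧ κ ≠ 1 ∧ κ * θ κ ^ 2 ≠ 1 := by
  obtain ⟨κ, hκ⟩ : ∃ κ, κ ∉ ({0, 1} : Set F) := by
    refine (Set.ne_univ_iff_exists_notMem _).1 fun huniv => hq.not_ge ?_
    rw [← Set.ncard_univ, ← huniv, Set.ncard_pair zero_ne_one]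
  obtain ⟨hκ0, hκ1⟩ := not_or.1 hκ
  refine ⟨κ, hκ0, hκ1, fun hκ2 => hκ1 (θ.injective ?_)⟩
  have hθκ : θ κ * κ = 1 := by simpa [hθ] using congrArg θ hκ2
  calc θ κ = θ κ * (θ κ * κ) := by rw [hθκ, mul_one]
    _ = κ * θ κ ^ 2 := by ring
    _ = θ 1 := by rw [hκ2, map_one]

/-- The commutator of the translation by `(a, b)` with a torus element moves the origin to a point
whose parameters are, up to the nonzero factors `κ + 1` and `κ θ(κ)² + 1`, triangular in `a, b`. -/
theorem exists_mem_suzukiGroup_smul_zero_eq [Finite F] [CharP F 2]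
    (hΨ : IsTitsCoordinates Q N T θ γ Ψ) (hq : 2 < Nat.card F) (x y : F) :
    ∃ g ∈ suzukiGroup Q N T,
      g • titsPoint Ψ θ (some (0, 0)) = titsPoint Ψ θ (some (x, y)) := by
  obtain ⟨κ, hκ0, hκ1, hκ2⟩ := exists_torus_parameter hΨ.map_map_sq hq
  have hκ1' : κ + 1 ≠ 0 := mt CharTwo.add_eq_zero.1 hκ1
  have hκ2' : κ * θ κ ^ 2 + 1 ≠ 0 := mt CharTwo.add_eq_zero.1 hκ2
  obtain ⟨a, ha⟩ : ∃ a, (κ + 1) * a = x := ⟨x / (κ + 1), mul_div_cancel₀ x hκ1'⟩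
  obtain ⟨b, hb⟩ : ∃ b, (κ * θ κ ^ 2 + 1) * b = y + (κ * θ κ ^ 2 + κ) * (θ a ^ 2 * a) :=
    ⟨_, mul_div_cancel₀ _ hκ2'⟩
  obtain ⟨k, hk, hk_smul⟩ := hΨ.exists_torus hκ0
  obtain ⟨τ, hτ, hτ_smul⟩ := hΨ.exists_translation a b
  refine ⟨τ * k * τ⁻¹ * k⁻¹, Subgroup.commutator_mem_commutator hτ hk, ?_⟩
  have hk_inv : k⁻¹ • titsPoint Ψ θ (some (0, 0)) = titsPoint Ψ θ (some (0, 0)) := by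
    rw [inv_smul_eq_iff, hk_smul, mul_zero, mul_zero]
  have hτ_inv : τ⁻¹ • titsPoint Ψ θ (some (0, 0)) =
      titsPoint Ψ θ (some (a, b + θ a ^ 2 * a)) := by
    rw [inv_smul_eq_iff, hτ_smul, add_assoc, CharTwo.add_self_eq_zero,
      CharTwo.add_self_eq_zero]
  rw [mul_smul, mul_smul, mul_smul, hk_inv, hτ_inv, hk_smul, hτ_smul]
  congr 3
  · linear_combination ha
  · linear_combination hb + (κ * θ κ ^ 2 + κ) * (θ a ^ 2 * a) * CharTwo.two_eq_zero (R := F)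

theorem exists_mem_suzukiGroup_smul_zero_eq_none [Finite F] [CharP F 2]
    (hΨ : IsTitsCoordinates Q N T θ γ Ψ) (hq : 2 < Nat.card F) :
    ∃ g ∈ suzukiGroup Q N T, g • titsPoint Ψ θ (some (0, 0)) = titsPoint Ψ θ none := by
  obtain ⟨w, hw, hw_zero, hw_smul⟩ := hΨ.exists_inversion
  obtain ⟨x, y, hxy⟩ := hw_smul 1 0 (by simp)
  obtain ⟨g, hg, hg_smul⟩ := hΨ.exists_mem_suzukiGroup_smul_zero_eq hq 1 0
  obtain ⟨g', hg', hg'_smul⟩ := hΨ.exists_mem_suzukiGroup_smul_zero_eq hq x y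
  have hconj : w * g * w⁻¹ ∈ suzukiGroup Q N T := by
    have hmem := mul_mem
      (Subgroup.commutator_mem_commutator hw (Subgroup.commutator_le_self _ hg)) hg
    rwa [commutatorElement_def, inv_mul_cancel_right] at hmem
  refine ⟨(w * g * w⁻¹)⁻¹ * g', mul_mem (inv_mem hconj) hg', ?_⟩
  rw [mul_smul, inv_smul_eq_iff, mul_smul, mul_smul, inv_smul_eq_iff.2 hw_zero.symm, hg_smul, hxy,
    hg'_smul]

theorem isTransitiveIsometryGroup_suzukiGroup [Finite F] [CharP F 2]
    (hΨ : IsTitsCoordinates Q N T θ γ Ψ) (hq : 2 < Nat.card F) :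
    IsTransitiveIsometryGroup (suzukiGroup Q N T) Q N T where
  map_form g hg := (Subgroup.commutator_le_self _ hg).1.1
  map_nucleus g hg := (Subgroup.commutator_le_self _ hg).1.2
  smul_mem g hg t ht :=
    (Subgroup.commutator_le_self _ hg).2.subset (Set.smul_mem_smul_set ht)
  exists_smul_eq := by
    have hzero (t : ℙ F V) (ht : t ∈ T) :
        ∃ g ∈ suzukiGroup Q N T, g • titsPoint Ψ θ (some (0, 0)) = t := by
      obtain ⟨_ | ⟨x, y⟩, rfl⟩ := hΨ.eq_range.subset ht
      · exact hΨ.exists_mem_suzukiGroup_smul_zero_eq_none hq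
      · exact hΨ.exists_mem_suzukiGroup_smul_zero_eq hq x y
    intro t ht t' ht'
    obtain ⟨g, hg, rfl⟩ := hzero t ht
    obtain ⟨g', hg', rfl⟩ := hzero t' ht'
    exact ⟨g' * g⁻¹, mul_mem hg' (inv_mem hg), by rw [mul_smul, inv_smul_smul]⟩

end IsTitsCoordinates

end SuzukiGroup

section Pencil

variable {F V : Type*} [Field F] [AddCommGroup V] [Module F V] {Q : QuadraticForm F V} {N : V}
  {c d : F}

theorem pencilForm_apply (Q : QuadraticForm F V) (N : V) (c : F) (x : V) :
    pencilForm Q N c x = Q x + c * Q.polarBilin N x ^ 2 := by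
  rw [sq]
  rfl

theorem pencilForm_apply_of_polarBilin_eq_zero {x : V} (hNx : Q.polarBilin N x = 0) :
    pencilForm Q N c x = Q x := by
  rw [pencilForm_apply, hNx, zero_pow two_ne_zero, mul_zero, add_zero]

theorem polarBilin_pencilForm [CharP F 2] (Q : QuadraticForm F V) (N : V) (c : F) :
    (pencilForm Q N c).polarBilin = Q.polarBilin := by
  ext x y
  have h := map_add_polarBilin (pencilForm Q N c) x y
  simp only [pencilForm_apply, map_add_polarBilin Q x y, map_add] at h
  linear_combination -h + c * Q.polarBilin N x * Q.polarBilin N y * CharTwo.two_eq_zero (R := F)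

theorem mem_baseLocus_iff_rep {p : ℙ F V} :
    p ∈ baseLocus Q N ↔ Q p.rep = 0 ∧ Q.polarBilin N p.rep = 0 := by
  rw [baseLocus, Set.mem_inter_iff, mem_quadric_iff_rep, mem_pointsOf_iff_rep, LinearMap.mem_ker]

theorem baseLocus_pencilForm [CharP F 2] (Q : QuadraticForm F V) (N : V) (c : F) :
    baseLocus (pencilForm Q N c) N = baseLocus Q N := by
  ext p
  rw [mem_baseLocus_iff_rep, mem_baseLocus_iff_rep, polarBilin_pencilForm]
  exact and_congr_left fun h => by rw [pencilForm_apply_of_polarBilin_eq_zero h]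

theorem baseLocus_subset_quadric_pencilForm [CharP F 2] (Q : QuadraticForm F V) (N : V) (c : F) :
    baseLocus Q N ⊆ quadric (pencilForm Q N c) := by
  rw [← baseLocus_pencilForm Q N c]
  exact Set.inter_subset_left

theorem quadric_pencilForm_inter_quadric_pencilForm [CharP F 2] (hcd : c ≠ d) :
    quadric (pencilForm Q N c) ∩ quadric (pencilForm Q N d) = baseLocus Q N := by
  refine Set.Subset.antisymm (fun p hp => ?_) (Set.subset_inter
    (baseLocus_subset_quadric_pencilForm Q N c) (baseLocus_subset_quadric_pencilForm Q N d))
  rw [Set.mem_inter_iff, mem_quadric_iff_rep, mem_quadric_iff_rep] at hp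
  have hsq : (c - d) * Q.polarBilin N p.rep ^ 2 = 0 := by
    linear_combination hp.1 - hp.2 - pencilForm_apply Q N c p.rep + pencilForm_apply Q N d p.rep
  have hNp : Q.polarBilin N p.rep = 0 :=
    pow_eq_zero_iff two_ne_zero |>.1 ((mul_eq_zero.1 hsq).resolve_left (sub_ne_zero.2 hcd))
  exact mem_baseLocus_iff_rep.2 ⟨pencilForm_apply_of_polarBilin_eq_zero hNp ▸ hp.1, hNp⟩

theorem IsOvoidFamily.pencilForm [CharP F 2] {ι : Type*} {τ : ι → V}
    (hτ : IsOvoidFamily Q N τ) (c : F) : IsOvoidFamily (pencilForm Q N c) N τ where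
  singular i := (pencilForm_apply_of_polarBilin_eq_zero (hτ.mem_perp i)).trans (hτ.singular i)
  mem_perp i := by rw [polarBilin_pencilForm, hτ.mem_perp]
  polarBilin_ne_zero i j hij := by
    rw [polarBilin_pencilForm]
    exact hτ.polarBilin_ne_zero i j hij
  card_eq := hτ.card_eq

theorem IsTransitiveIsometryGroup.pencilForm {G : Subgroup (V ≃ₗ[F] V)} {T : Set (ℙ F V)}
    (hG : IsTransitiveIsometryGroup G Q N T) (c : F) :
    IsTransitiveIsometryGroup G (pencilForm Q N c) N T where
  map_form g hg x := by
    rw [pencilForm_apply, pencilForm_apply, hG.map_form g hg, hG.polarBilin_nucleus_map hg]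
  map_nucleus := hG.map_nucleus
  smul_mem := hG.smul_mem
  exists_smul_eq := hG.exists_smul_eq

theorem IsPolarLine.finite_pointsOf [Finite F] {B : LinearMap.BilinForm F V} {l : Submodule F V}
    (hl : IsPolarLine B l) : (pointsOf l).Finite :=
  Set.finite_of_ncard_ne_zero (by rw [ncard_pointsOf_of_finrank_two hl.1]; exact Nat.succ_ne_zero _)

section LineIntersections

variable [Finite F] [CharP F 2] {A A' : Set (ℙ F V)} {l : Submodule F V}

theorem IsPolarLine.subset_quadric_pencilForm_or_ncard_inter_eq_one
    (hl : IsPolarLine Q.polarBilin l) (c : F) :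
    pointsOf l ⊆ quadric (pencilForm Q N c) ∨
      (pointsOf l ∩ quadric (pencilForm Q N c)).ncard = 1 :=
  subset_quadric_or_ncard_inter_eq_one (by rwa [polarBilin_pencilForm])

theorem IsPolarLine.ncard_inter_union_baseLocus_of_subset_quadric (hl : IsPolarLine Q.polarBilin l)
    (hcd : c ≠ d) (hA : A ⊆ quadric (pencilForm Q N c) \ baseLocus Q N)
    (hA' : A' ⊆ quadric (pencilForm Q N d) \ baseLocus Q N)
    (hlc : pointsOf l ⊆ quadric (pencilForm Q N c))
    (hld : ¬ pointsOf l ⊆ quadric (pencilForm Q N d)) :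
    (pointsOf l ∩ baseLocus Q N).ncard = 1 ∧
      (pointsOf l ∩ (A ∪ A' ∪ baseLocus Q N)).ncard = (pointsOf l ∩ A).ncard + 1 := by
  have hfin (S : Set (ℙ F V)) : (pointsOf l ∩ S).Finite :=
    hl.finite_pointsOf.subset Set.inter_subset_left
  have hbase : pointsOf l ∩ baseLocus Q N = pointsOf l ∩ quadric (pencilForm Q N d) := by
    rw [← quadric_pencilForm_inter_quadric_pencilForm hcd, ← Set.inter_assoc,
      Set.inter_eq_left.2 hlc]
  have hone : (pointsOf l ∩ baseLocus Q N).ncard = 1 := by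
    rw [hbase]
    exact (hl.subset_quadric_pencilForm_or_ncard_inter_eq_one d).resolve_left hld
  have hA'_base : pointsOf l ∩ A' ⊆ pointsOf l ∩ baseLocus Q N := by
    rw [hbase]
    exact Set.inter_subset_inter_right _ fun p hp => (hA' hp).1
  have hdisj : Disjoint (pointsOf l ∩ A) (pointsOf l ∩ baseLocus Q N) :=
    Set.disjoint_left.2 fun p hp hp' => (hA hp.2).2 hp'.2
  refine ⟨hone, ?_⟩
  rw [Set.inter_union_distrib_left, Set.inter_union_distrib_left, Set.union_assoc,
    Set.union_eq_right.2 hA'_base, Set.ncard_union_eq hdisj (hfin A) (hfin _), hone]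

theorem IsPolarLine.ncard_inter_union_baseLocus_le_two (hl : IsPolarLine Q.polarBilin l)
    (hA : A ⊆ quadric (pencilForm Q N c)) (hA' : A' ⊆ quadric (pencilForm Q N d))
    (hlc : ¬ pointsOf l ⊆ quadric (pencilForm Q N c))
    (hld : ¬ pointsOf l ⊆ quadric (pencilForm Q N d)) :
    (pointsOf l ∩ (A ∪ A' ∪ baseLocus Q N)).ncard ≤ 2 := by
  have hsub : A ∪ A' ∪ baseLocus Q N ⊆
      quadric (pencilForm Q N c) ∪ quadric (pencilForm Q N d) :=
    Set.union_subset (Set.union_subset_union hA hA')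
      ((baseLocus_subset_quadric_pencilForm Q N c).trans Set.subset_union_left)
  calc (pointsOf l ∩ (A ∪ A' ∪ baseLocus Q N)).ncard
      ≤ (pointsOf l ∩ (quadric (pencilForm Q N c) ∪ quadric (pencilForm Q N d))).ncard :=
        Set.ncard_le_ncard (Set.inter_subset_inter_right _ hsub)
          (hl.finite_pointsOf.subset Set.inter_subset_left)
    _ ≤ (pointsOf l ∩ quadric (pencilForm Q N c)).ncard +
          (pointsOf l ∩ quadric (pencilForm Q N d)).ncard := by
        rw [Set.inter_union_distrib_left]
        exact Set.ncard_union_le _ _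
    _ = 2 := by
        rw [(hl.subset_quadric_pencilForm_or_ncard_inter_eq_one c).resolve_left hlc,
          (hl.subset_quadric_pencilForm_or_ncard_inter_eq_one d).resolve_left hld]

theorem IsPolarLine.inter_union_baseLocus_cases (hl : IsPolarLine Q.polarBilin l) (hcd : c ≠ d)
    (hA : A ⊆ quadric (pencilForm Q N c) \ baseLocus Q N)
    (hA' : A' ⊆ quadric (pencilForm Q N d) \ baseLocus Q N) :
    (pointsOf l ⊆ baseLocus Q N ∧
      (pointsOf l ∩ (A ∪ A' ∪ baseLocus Q N)).ncard = Nat.card F + 1) ∨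
    (¬ pointsOf l ⊆ quadric (pencilForm Q N c) ∧ ¬ pointsOf l ⊆ quadric (pencilForm Q N d) ∧
      (pointsOf l ∩ (A ∪ A' ∪ baseLocus Q N)).ncard ≤ 2) ∨
    (pointsOf l ⊆ quadric (pencilForm Q N c) ∧ (pointsOf l ∩ baseLocus Q N).ncard = 1 ∧
      (pointsOf l ∩ (A ∪ A' ∪ baseLocus Q N)).ncard = (pointsOf l ∩ A).ncard + 1) ∨
    (pointsOf l ⊆ quadric (pencilForm Q N d) ∧ (pointsOf l ∩ baseLocus Q N).ncard = 1 ∧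
      (pointsOf l ∩ (A ∪ A' ∪ baseLocus Q N)).ncard = (pointsOf l ∩ A').ncard + 1) := by
  by_cases hc : pointsOf l ⊆ quadric (pencilForm Q N c) <;>
    by_cases hd : pointsOf l ⊆ quadric (pencilForm Q N d)
  · have hbase : pointsOf l ⊆ baseLocus Q N :=
      quadric_pencilForm_inter_quadric_pencilForm (Q := Q) (N := N) hcd ▸ Set.subset_inter hc hd
    refine Or.inl ⟨hbase, ?_⟩
    rw [Set.inter_eq_left.2 (hbase.trans Set.subset_union_right),
      ncard_pointsOf_of_finrank_two hl.1]
  · exact Or.inr (Or.inr (Or.inl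
      ⟨hc, hl.ncard_inter_union_baseLocus_of_subset_quadric hcd hA hA' hc hd⟩))
  · rw [Set.union_comm A A']
    exact Or.inr (Or.inr (Or.inr
      ⟨hd, hl.ncard_inter_union_baseLocus_of_subset_quadric hcd.symm hA' hA hd hc⟩))
  · exact Or.inr (Or.inl ⟨hc, hd, hl.ncard_inter_union_baseLocus_le_two
      (hA.trans Set.sdiff_subset) (hA'.trans Set.sdiff_subset) hc hd⟩)

end LineIntersections

open scoped Classical in
/-- A set of points of `Q + c B(N, ·)² = 0` off the base locus that meets a line of this quadric
with a single point `P` in the base locus in `q / 2` points if `P ∈ T`, and in `(q - s) / 2` points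
otherwise. Relative hemisystems are the case `s = 0`; the orbits of the Suzuki group have
`s = ± √(2q)`. -/
structure HasTangentLineNumbers (Q : QuadraticForm F V) (N : V) (c : F) (T : Set (ℙ F V)) (s : ℤ)
    (A : Set (ℙ F V)) : Prop where
  subset : A ⊆ quadric (pencilForm Q N c) \ baseLocus Q N
  two_mul_ncard_inter (l : Submodule F V) (hl : IsPolarLine Q.polarBilin l)
    (hlc : pointsOf l ⊆ quadric (pencilForm Q N c)) (P : ℙ F V)
    (hP : pointsOf l ∩ baseLocus Q N = {P}) :
    2 * ((pointsOf l ∩ A).ncard : ℤ) = if P ∈ T then (Nat.card F : ℤ) else Nat.card F - s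

theorem IsRelativeHemisystem.hasTangentLineNumbers {R : Set (ℙ F V)}
    (hR : IsRelativeHemisystem (quadric (pencilForm Q N c)) (baseLocus Q N) R) :
    HasTangentLineNumbers Q N c ∅ 0 R where
  subset := hR.1
  two_mul_ncard_inter l hl hlc P hP := by
    rw [if_neg (Set.notMem_empty P), sub_zero]
    exact_mod_cast hR.2.2 l hl.1 hlc (by rw [hP, Set.ncard_singleton])

theorem IsOrbitOn.subset_quadric_diff_baseLocus {G : Subgroup (V ≃ₗ[F] V)} {A T : Set (ℙ F V)}
    (hG : IsTransitiveIsometryGroup G Q N T) (hA : IsOrbitOn G (quadric Q \ baseLocus Q N) A) :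
    A ⊆ quadric Q \ baseLocus Q N := by
  obtain ⟨x₀, hx₀, hx₀Q, rfl⟩ := hA.exists_mem_affineQuadric
  rintro _ ⟨⟨g, hg⟩, rfl⟩
  have hgx₀ : g x₀ ≠ 0 := g.map_ne_zero_iff.2 hx₀
  refine ⟨(mk_mem_quadric hgx₀).2 ((hG.map_form g hg x₀).trans hx₀Q.1), fun h => ?_⟩
  have hNgx₀ : Q.polarBilin N (g x₀) = 0 := (mk_mem_pointsOf hgx₀).1 h.2
  rw [hG.polarBilin_nucleus_map hg, hx₀Q.2] at hNgx₀
  exact one_ne_zero hNgx₀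

theorem IsOrbitOn.hasTangentLineNumbers [Finite F] [CharP F 2] {G : Subgroup (V ≃ₗ[F] V)}
    {A T : Set (ℙ F V)} (hA : IsOrbitOn G (quadric (pencilForm Q N c) \ baseLocus Q N) A)
    (hG : IsTransitiveIsometryGroup G Q N T) (hT : IsOvoidFamily Q N (repFamily T))
    (hV : finrank F V = 6) (hc : IsElliptic (pencilForm Q N c)) (hN : Q N ≠ 0)
    (hq : 8 ≤ Nat.card F) {s : ℤ} (hs : s ^ 2 = 2 * Nat.card F)
    (hcard : (A.ncard : ℝ) =
      ((Nat.card F : ℝ) ^ 3 - (Nat.card F : ℝ) ^ 2) * ((Nat.card F : ℝ) - s + 1) / 2) :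
    HasTangentLineNumbers Q N c T s A := by
  rw [← baseLocus_pencilForm Q N c] at hA
  have hcardℤ : 2 * (A.ncard : ℤ) =
      ((Nat.card F : ℤ) - 1) * Nat.card F ^ 2 * (Nat.card F + 1 - s) := by
    rify
    rw [hcard]
    ring
  have hNc : pencilForm Q N c N ≠ 0 := by
    rwa [pencilForm_apply_of_polarBilin_eq_zero (polarBilin_self Q N)]
  refine ⟨?_, fun l hl hlc P hP => ?_⟩
  · rw [← baseLocus_pencilForm Q N c]
    exact hA.subset_quadric_diff_baseLocus (hG.pencilForm c)
  · rw [← polarBilin_pencilForm Q N c] at hl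
    rw [← baseLocus_pencilForm Q N c] at hP
    exact (hG.pencilForm c).two_mul_ncard_line_inter_orbit (hT.pencilForm c) hV hc hNc hq hs hA
      hcardℤ hl hlc hP

namespace HasTangentLineNumbers

variable {A A' T : Set (ℙ F V)} {s s' : ℤ} {l : Submodule F V}

theorem two_mul_ncard_inter_eq_or (hA : HasTangentLineNumbers Q N c T s A)
    (hl : IsPolarLine Q.polarBilin l) (hlc : pointsOf l ⊆ quadric (pencilForm Q N c))
    (hone : (pointsOf l ∩ baseLocus Q N).ncard = 1) :
    2 * ((pointsOf l ∩ A).ncard : ℤ) = Nat.card F ∨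
      2 * ((pointsOf l ∩ A).ncard : ℤ) = Nat.card F - s := by
  obtain ⟨P, hP⟩ := Set.ncard_eq_one.1 hone
  rw [hA.two_mul_ncard_inter l hl hlc P hP]
  split_ifs
  · exact Or.inl rfl
  · exact Or.inr rfl

theorem two_mul_ncard_inter_eq_card_iff (hA : HasTangentLineNumbers Q N c T s A) (hs : s ≠ 0)
    (hl : IsPolarLine Q.polarBilin l) (hlc : pointsOf l ⊆ quadric (pencilForm Q N c))
    (hone : (pointsOf l ∩ baseLocus Q N).ncard = 1) :
    2 * ((pointsOf l ∩ A).ncard : ℤ) = Nat.card F ↔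
      ∃ t ∈ T, pointsOf l ∩ baseLocus Q N = {t} := by
  obtain ⟨P, hP⟩ := Set.ncard_eq_one.1 hone
  simp only [hA.two_mul_ncard_inter l hl hlc P hP, hP, Set.singleton_eq_singleton_iff,
    exists_eq_right']
  split_ifs with hPT
  · simp only [hPT]
  · simpa only [hPT, iff_false, sub_eq_self] using hs

variable [Finite F] [CharP F 2]

theorem ncard_line_inter_union_cases (hA : HasTangentLineNumbers Q N c T s A)
    (hA' : HasTangentLineNumbers Q N d T s' A') (hcd : c ≠ d) (hl : IsPolarLine Q.polarBilin l) :
    (pointsOf l ∩ (A ∪ A' ∪ baseLocus Q N)).ncard ≤ 2 ∨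
    (pointsOf l ∩ (A ∪ A' ∪ baseLocus Q N)).ncard = Nat.card F + 1 ∨
    2 * ((pointsOf l ∩ (A ∪ A' ∪ baseLocus Q N)).ncard : ℤ) = Nat.card F + 2 ∨
    2 * ((pointsOf l ∩ (A ∪ A' ∪ baseLocus Q N)).ncard : ℤ) = Nat.card F - s + 2 ∨
    2 * ((pointsOf l ∩ (A ∪ A' ∪ baseLocus Q N)).ncard : ℤ) = Nat.card F - s' + 2 := by
  rcases hl.inter_union_baseLocus_cases hcd hA.subset hA'.subset with
    ⟨-, hn⟩ | ⟨-, -, hn⟩ | ⟨hlc, hone, hn⟩ | ⟨hld, hone, hn⟩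
  · exact Or.inr (Or.inl hn)
  · exact Or.inl hn
  · have := hA.two_mul_ncard_inter_eq_or hl hlc hone
    lia
  · have := hA'.two_mul_ncard_inter_eq_or hl hld hone
    lia

theorem two_mul_ncard_line_inter_union_eq_iff (hA : HasTangentLineNumbers Q N c T s A)
    (hA' : HasTangentLineNumbers Q N d T s' A') (hcd : c ≠ d) (hs : s ≠ 0) (hs' : s' ≠ 0)
    (hq : 2 < Nat.card F) (hl : IsPolarLine Q.polarBilin l) :
    2 * ((pointsOf l ∩ (A ∪ A' ∪ baseLocus Q N)).ncard : ℤ) = Nat.card F + 2 ↔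
      (pointsOf l ⊆ quadric (pencilForm Q N c) ∨ pointsOf l ⊆ quadric (pencilForm Q N d)) ∧
        ∃ t ∈ T, pointsOf l ∩ baseLocus Q N = {t} := by
  rcases hl.inter_union_baseLocus_cases hcd hA.subset hA'.subset with
    ⟨hbase, hn⟩ | ⟨hlc, hld, hn⟩ | ⟨hlc, hone, hn⟩ | ⟨hld, hone, hn⟩
  · refine iff_of_false (by lia) ?_
    rintro ⟨-, t, -, ht⟩
    have hcard := ncard_pointsOf_of_finrank_two hl.1
    rw [← Set.inter_eq_left.2 hbase, ht, Set.ncard_singleton] at hcard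
    lia
  · exact iff_of_false (by lia) fun h => h.1.elim hlc hld
  · rw [← hA.two_mul_ncard_inter_eq_card_iff hs hl hlc hone, and_iff_right (Or.inl hlc)]
    lia
  · rw [← hA'.two_mul_ncard_inter_eq_card_iff hs' hl hld hone, and_iff_right (Or.inr hld)]
    lia

theorem ncard_polarLines_subset_union (hA : HasTangentLineNumbers Q N c T s A)
    (hA' : HasTangentLineNumbers Q N d T s' A') (hcd : c ≠ d) (hV : finrank F V = 6)
    (hB : Q.polarBilin.Nondegenerate) (hN : Q N ≠ 0) (hs : |s| < Nat.card F)
    (hs' : |s'| < Nat.card F) :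
    {l : Submodule F V | IsPolarLine Q.polarBilin l ∧
      pointsOf l ⊆ A ∪ A' ∪ baseLocus Q N}.ncard = (Nat.card F + 1) * (Nat.card F ^ 2 + 1) := by
  rw [← ncard_singularLines hV hB hN]
  congr 1
  ext l
  refine and_congr_right fun hl => ⟨fun h => ?_, fun h => h.trans Set.subset_union_right⟩
  have hq : 1 < Nat.card F := Finite.one_lt_card
  have hcount : (pointsOf l ∩ (A ∪ A' ∪ baseLocus Q N)).ncard = Nat.card F + 1 := by
    rw [Set.inter_eq_left.2 h, ncard_pointsOf_of_finrank_two hl.1]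
  rw [abs_lt] at hs hs'
  rcases hl.inter_union_baseLocus_cases hcd hA.subset hA'.subset with
    ⟨hbase, -⟩ | ⟨-, -, hn⟩ | ⟨hlc, hone, hn⟩ | ⟨hld, hone, hn⟩
  · exact hbase
  · lia
  · have := hA.two_mul_ncard_inter_eq_or hl hlc hone
    lia
  · have := hA'.two_mul_ncard_inter_eq_or hl hld hone
    lia

theorem ncard_line_inter_union_mem (hA : HasTangentLineNumbers Q N c T 0 A)
    (hA' : HasTangentLineNumbers Q N d T 0 A') (hcd : c ≠ d) (hl : IsPolarLine Q.polarBilin l) :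
    (pointsOf l ∩ (A ∪ A' ∪ baseLocus Q N)).ncard ∈
      ({0, 1, 2, Nat.card F / 2 + 1, Nat.card F + 1} : Set ℕ) := by
  simp only [Set.mem_insert_iff, Set.mem_singleton_iff]
  have := hA.ncard_line_inter_union_cases hA' hcd hl
  lia

theorem ncard_line_inter_union_mem_real (hA : HasTangentLineNumbers Q N c T s A)
    (hA' : HasTangentLineNumbers Q N d T (-s) A') (hcd : c ≠ d)
    (hl : IsPolarLine Q.polarBilin l) :
    ((pointsOf l ∩ (A ∪ A' ∪ baseLocus Q N)).ncard : ℝ) ∈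
      ({0, 1, 2, ((Nat.card F : ℝ) - s) / 2 + 1, (Nat.card F : ℝ) / 2 + 1,
        ((Nat.card F : ℝ) + s) / 2 + 1, (Nat.card F : ℝ) + 1} : Set ℝ) := by
  have hcases := hA.ncard_line_inter_union_cases hA' hcd hl
  generalize (pointsOf l ∩ (A ∪ A' ∪ baseLocus Q N)).ncard = n at hcases ⊢
  simp only [Set.mem_insert_iff, Set.mem_singleton_iff]
  rcases hcases with hn | hn | hn | hn | hn
  · interval_cases n <;> norm_num
  all_goals
    rify at hn
    grind

theorem ncard_line_inter_union_eq_iff (hA : HasTangentLineNumbers Q N c T s A)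
    (hA' : HasTangentLineNumbers Q N d T s' A') (hcd : c ≠ d) (hs : s ≠ 0) (hs' : s' ≠ 0)
    (hq : 2 < Nat.card F) (hl : IsPolarLine Q.polarBilin l) :
    ((pointsOf l ∩ (A ∪ A' ∪ baseLocus Q N)).ncard : ℝ) = (Nat.card F : ℝ) / 2 + 1 ↔
      (pointsOf l ⊆ quadric (pencilForm Q N c) ∨ pointsOf l ⊆ quadric (pencilForm Q N d)) ∧
        ∃ t ∈ T, pointsOf l ∩ baseLocus Q N = {t} := by
  rw [← hA.two_mul_ncard_line_inter_union_eq_iff hA' hcd hs hs' hq hl]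
  rify
  constructor <;> intro h <;> linarith

end HasTangentLineNumbers

end Pencil

theorem exists_sqrt_two_mul_eq {h q : ℕ} (hh : 0 < h) (hq : q = 2 ^ (2 * h + 1)) :
    8 ≤ q ∧ ∃ s : ℤ, 0 < s ∧ s < q ∧ s ^ 2 = 2 * q ∧ √(2 * (q : ℝ)) = s := by
  have hq8 : 8 ≤ q := hq ▸ Nat.pow_le_pow_right (n := 2) (i := 3) two_pos (by lia)
  have hpos : 0 < (2 ^ (h + 1) : ℤ) := by positivity
  have hsq : (2 ^ (h + 1) : ℤ) ^ 2 = 2 * q := by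
    rw [hq]
    push_cast
    ring
  refine ⟨hq8, 2 ^ (h + 1), hpos, by nlinarith, hsq, ?_⟩
  have hsqℝ : 2 * (q : ℝ) = ((2 ^ (h + 1) : ℤ) : ℝ) ^ 2 := by exact_mod_cast hsq.symm
  rw [hsqℝ, Real.sqrt_sq (by exact_mod_cast hpos.le)]

theorem mainTheorem10 {F V : Type*} [Field F] [Finite F] [CharP F 2] [AddCommGroup V] [Module F V]
    (hV : finrank F V = 6) (q : ℕ) (hq : Nat.card F = q)
    (B : LinearMap.BilinForm F V) (hBalt : B.IsAlt) (hB : B.Nondegenerate)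
    (Q : QuadraticForm F V) (hQ : Q.polarBilin = B) (N : V) (hN : Q N ≠ 0)
    (cj ck : F) (hjk : cj ≠ ck)
    (hj : IsElliptic (pencilForm Q N cj)) (hk : IsElliptic (pencilForm Q N ck)) :
    (∀ Rj Rk : Set (ℙ F V),
      IsRelativeHemisystem (quadric (pencilForm Q N cj)) (baseLocus Q N) Rj →
      IsRelativeHemisystem (quadric (pencilForm Q N ck)) (baseLocus Q N) Rk →
      (∀ l : Submodule F V, IsPolarLine B l →
        (pointsOf l ∩ (Rj ∪ Rk ∪ baseLocus Q N)).ncard ∈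
          ({0, 1, 2, q / 2 + 1, q + 1} : Set ℕ)) ∧
      {l : Submodule F V | IsPolarLine B l ∧
        pointsOf l ⊆ Rj ∪ Rk ∪ baseLocus Q N}.ncard = (q + 1) * (q ^ 2 + 1)) ∧
    (∀ h : ℕ, 0 < h → q = 2 ^ (2 * h + 1) →
      ∀ T : Set (ℙ F V), IsSuzukiTitsOvoid h Q N T →
      ∀ Aj Bk : Set (ℙ F V),
      IsOrbitOn (suzukiGroup Q N T) (quadric (pencilForm Q N cj) \ baseLocus Q N) Aj →
      (Aj.ncard : ℝ) = ((q : ℝ) ^ 3 - (q : ℝ) ^ 2) * ((q : ℝ) - √(2 * (q : ℝ)) + 1) / 2 →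
      IsOrbitOn (suzukiGroup Q N T) (quadric (pencilForm Q N ck) \ baseLocus Q N) Bk →
      (Bk.ncard : ℝ) = ((q : ℝ) ^ 3 - (q : ℝ) ^ 2) * ((q : ℝ) + √(2 * (q : ℝ)) + 1) / 2 →
      (∀ l : Submodule F V, IsPolarLine B l →
        ((pointsOf l ∩ (Aj ∪ Bk ∪ baseLocus Q N)).ncard : ℝ) ∈
          ({0, 1, 2, ((q : ℝ) - √(2 * (q : ℝ))) / 2 + 1, (q : ℝ) / 2 + 1,
            ((q : ℝ) + √(2 * (q : ℝ))) / 2 + 1, (q : ℝ) + 1} : Set ℝ) ∧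
        (((pointsOf l ∩ (Aj ∪ Bk ∪ baseLocus Q N)).ncard : ℝ) = (q : ℝ) / 2 + 1 ↔
          (pointsOf l ⊆ quadric (pencilForm Q N cj) ∨
            pointsOf l ⊆ quadric (pencilForm Q N ck)) ∧
          ∃ t ∈ T, pointsOf l ∩ baseLocus Q N = {t})) ∧
      {l : Submodule F V | IsPolarLine B l ∧
        pointsOf l ⊆ Aj ∪ Bk ∪ baseLocus Q N}.ncard = (q + 1) * (q ^ 2 + 1)) := by
  subst hQ hq
  refine ⟨fun Rj Rk hRj hRk => ?_, fun h hh hq T hT Aj Bk hAj hAj_card hBk hBk_card => ?_⟩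
  · have hRj := hRj.hasTangentLineNumbers
    have hRk := hRk.hasTangentLineNumbers
    have hq : |(0 : ℤ)| < Nat.card F := by simp only [abs_zero, Nat.cast_pos, Nat.card_pos]
    exact ⟨fun l hl => hRj.ncard_line_inter_union_mem hRk hjk hl,
      hRj.ncard_polarLines_subset_union hRk hjk hV hB hN hq hq⟩
  · obtain ⟨hq8, s, hs_pos, hs_lt, hs_sq, hs_sqrt⟩ := exists_sqrt_two_mul_eq hh hq
    rw [hs_sqrt] at hAj_card hBk_card ⊢
    rw [← sub_neg_eq_add _ (s : ℝ), ← Int.cast_neg] at hBk_card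
    obtain ⟨θ, γ, Ψ, hΨ⟩ := hT.exists_isTitsCoordinates hV hB hq
    have hG := hΨ.isTransitiveIsometryGroup_suzukiGroup (by lia)
    have hAj := hAj.hasTangentLineNumbers hG hΨ.isOvoidFamily hV hj hN hq8 hs_sq hAj_card
    have hBk := hBk.hasTangentLineNumbers hG hΨ.isOvoidFamily hV hk hN hq8
      ((neg_sq s).trans hs_sq) hBk_card
    have hs_abs : |s| < Nat.card F := by rwa [abs_of_pos hs_pos]
    exact ⟨fun l hl => ⟨hAj.ncard_line_inter_union_mem_real hBk hjk hl,
        hAj.ncard_line_inter_union_eq_iff hBk hjk hs_pos.ne' (neg_ne_zero.2 hs_pos.ne')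
          (by lia) hl⟩,
      hAj.ncard_polarLines_subset_union hBk hjk hV hB hN hs_abs ((abs_neg s).trans_lt hs_abs)⟩
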